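/- Let $q\in\mathbb{C}$ with $0<|q|<1$. Write $(x)_\infty=\prod_{j\ge 0}(1-xq^j)$ and, for $n\in\mathbb{Z}$, $(x)_n=(x)_\infty/(xq^n)_\infty$; that is, $(x)_n=\prod_{j=0}^{n-1}(1-xq^j)$ for $n\ge 0$ and $1/(x)_{-k}=\prod_{j=1}^{k}(1-xq^{-j})$ for $k>0$ (so $1/(q)_{-k}=0$ for $k>0$, and likewise $1/(q^{k})_{-k}=0$). Let $${}_{r+1}\phi_r\left({a,b_1,\dots,b_r\atop c_1,\dots,c_r};q,x\right)=\sum_{i=0}^\infty\frac{(a)_i(b_1)_i\cdots(b_r)_i}{(q)_i(c_1)_i\cdots(c_r)_i}x^i .$$ Let $m\in\mathbb{Z}$, let $r,n_1,\dots,n_r,s\in\mathbb{Z}_{\ge 0}$, put $N=n_1+\dots+n_r$, and let $a,b,c_1,\dots,c_r$ be nonzero complex numbers such that none of $bq^{m+1}$, $c_k$, $bq/a$, $bq^{1-n_k}/c_k$ $(1\le k\le r)$ is $1$ or a negative integer power of $q$. (1) Suppose also that neither $q/a$ nor $bq$ is $1$ or a negative integer power of $q$ (that is, $(q/a)_\infty(bq)_\infty\ne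 0$). If $|a^{-1}q^{m+1-N-s}|<1$, then both series below converge absolutely and $${}_{r+2}\phi_{r+1}\left({a,\,b,\,c_1q^{n_1},\dots,c_rq^{n_r}\atop bq^{m+1},\,c_1,\dots,c_r};q,\,a^{-1}q^{m+1-N-s}\right)$$ $$=\frac{(q)_\infty(bq/a)_\infty(bq)_m(c_1/b)_{n_1}\cdots(c_r/b)_{n_r}}{(q/a)_\infty(bq)_\infty(q)_m(c_1)_{n_1}\cdots(c_r)_{n_r}}\,b^{N-m+s}\;{}_{r+2}\phi_{r+1}\left({q^{-m},\,b,\,bq/c_1,\dots,bq/c_r\atop bq/a,\,bq^{1-n_1}/c_1,\dots,bq^{1-n_r}/c_r};q,\,q^{1+s}\right).$$ (2) Suppose also that $b$ is not $1$ or a negative integer power of $q$ (that is, $(b)_\infty\neq0$). If $|a^{-1}q^{m+1-N+s+\min\{r-2,0\}s}|<1$ and $\min\{n_1,\dots,n_r,s\}=s$, then all series on the left below, and those on the right with $i\le m$, converge absolutely and $$\sum_{i=0}^s\frac{(q^{-s})_i}{(q)_i}q^{si}\,\frac{(q^{1-i}/a)_\infty(q^{1-n_1}/c_1)_{n_1-i}\cdots(q^{1-n_r}/c_r)_{n_r-i}}{(q)_\infty(q^{-m}/b)_{m-i+1}}$$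 $$\times\;{}_{r+2}\phi_{r+1}\left({aq^i,\,bq^i,\,c_1q^{n_1},\dots,c_rq^{n_r}\atop bq^{m+1},\,c_1q^i,\dots,c_rq^i};q,\,a^{-1}q^{m+1-N+s+(r-2)i}\right)$$ $$=-\sum_{i=0}^s\frac{(q^{-s})_i}{(q)_i}q^i\,\frac{(bq/a)_\infty(bq^{1-n_1+i}/c_1)_{n_1-i}\cdots(bq^{1-n_r+i}/c_r)_{n_r-i}}{(bq^i)_\infty(q^{i-m})_{m-i}}\,b^{1-s}$$ $$\times\;{}_{r+2}\phi_{r+1}\left({q^{i-m},\,bq^i,\,bq/c_1,\dots,bq/c_r\atop bq/a,\,bq^{1-n_1+i}/c_1,\dots,bq^{1-n_r+i}/c_r};q,\,q^{1-s}\right),$$ where the terms with $i>m$ on the right are $0$ because of the factor $1/(q^{i-m})_{m-i}=0$. -/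

import Mathlib

/-- The infinite `q`-shifted factorial `(a; q)_∞ = ∏_{j ≥ 0} (1 - a q^j)`. -/
noncomputable def qPochInf (q a : ℂ) : ℂ :=
  ∏' j : ℕ, (1 - a * q ^ j)

/-- The `q`-shifted factorial `(a; q)_n = (a; q)_∞ / (a q^n; q)_∞` for an integer `n`, with the
quotient of infinite products written out as a finite product:
`(a; q)_n = (1 - a) (1 - a q) ⋯ (1 - a q^(n-1))` for `n ≥ 0`, and
`(a; q)_{-k} = 1 / ((1 - a q^(-k)) ⋯ (1 - a q^(-1)))` for `k > 0`.
In particular `1 / (a; q)_{-k} = (1 - a q^(-k)) ⋯ (1 - a q^(-1))` always holds, also when this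
product vanishes (as it does for `a = q`, `k > 0`). -/
noncomputable def qPoch (q a : ℂ) : ℤ → ℂ
  | Int.ofNat n => ∏ j ∈ Finset.range n, (1 - a * q ^ j)
  | Int.negSucc n => (∏ j ∈ Finset.range (n + 1), (1 - a * q ^ (-((j : ℤ) + 1))))⁻¹

/-- The `i`-th term of the basic hypergeometric series
`_{r+1}φ_r(a, b_1, …, b_r; c_1, …, c_r; q, x)`. -/
noncomputable def qHypTerm (q : ℂ) {r : ℕ} (a : ℂ) (b c : Fin r → ℂ) (x : ℂ) (i : ℕ) : ℂ :=
  (qPoch q a i * ∏ k, qPoch q (b k) i) / (qPoch q q i * ∏ k, qPoch q (c k) i) * x ^ i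

/-- The basic hypergeometric series `_{r+1}φ_r(a, b_1, …, b_r; c_1, …, c_r; q, x)`. -/
noncomputable def qHyp (q : ℂ) {r : ℕ} (a : ℂ) (b c : Fin r → ℂ) (x : ℂ) : ℂ :=
  ∑' i : ℕ, qHypTerm q a b c x i

/-- `c` is admissible as a denominator parameter of a basic hypergeometric series:
it is neither `1` nor a negative integer power of `q`. -/
def qAdmissible (q c : ℂ) : Prop :=
  ∀ k : ℕ, c ≠ q ^ (-(k : ℤ))

/-!
Write `w = q^(-l)` for the summation index `l` of a left-hand series. A quotient such as
`(c q^n)_l / (c)_l` or `(b)_l / (b q^(m+1))_l` depends on `l` only through a shifted factorial of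
fixed length in `w` (`qPoch_div_qPoch_mul_zpow`), so every series on the left is a value of the
linear functional `G ↦ ∑ (a)_l / (q)_l a^(-l) G(q^(-l))` at a rational function
`p(w) / ∏_{j ≤ m} (1 - w / (b q^j))`. The argument of the series is exactly what makes `p` a
polynomial in `w`, and its degree is what the hypothesis on the argument controls.

The functional is evaluated by partial fractions. It kills polynomials in `w`, because the
`q`-binomial theorem gives `∑ (a)_l / (q)_l (q^(-k) / a)^l = (q^(-k))_∞ / (q^(-k) / a)_∞ = 0`, and on
a simple pole `1 / (w - x)` it is a `q`-Gauss sum, equal to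
`(q)_∞ (x q / a)_∞ / ((q / a)_∞ (x)_∞)`. The separate pieces converge only for `|q / a| < 1`; other
values of `a` are reached by stepping from `a` to `a q`, which multiplies `p` by `w - a`
(`qPochInf_mul_qBinomialSum_nodal`). The result, a finite sum over the poles `w = b q^j`, is
`qPochInf_mul_qBinomialSum_div`. For the first identity this sum is the right-hand series.

In the second identity the `i`-th term on the left has numerator `P_i(w) / w^s`, which is not a
polynomial, so its partial fraction expansion has extra terms. They disappear from the sum over `i`:
up to a common factor `P_i(w)` is `(q^(-s))_i / (q)_i q^i B(w q^i)` with one power series `B`, and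
`∑_i (q^(-s))_i / (q)_i q^(i (l + 1)) = 0` for `l < s`, so `w^s` divides `∑_i P_i`
(`X_pow_dvd_sum_qPochPoly`). The remaining residues match the right-hand side term by term
(`residue_eq_summand`).
-/

open Filter Topology

/-! ### `q`-shifted factorials -/

theorem qPoch_natCast (q x : ℂ) (n : ℕ) :
    qPoch q x (n : ℤ) = ∏ j ∈ Finset.range n, (1 - x * q ^ j) := rfl

theorem qPoch_zero (q x : ℂ) : qPoch q x 0 = 1 := by
  simpa using qPoch_natCast q x 0

theorem qPoch_negSucc (q x : ℂ) (n : ℕ) :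
    qPoch q x (Int.negSucc n) =
      (∏ j ∈ Finset.range (n + 1), (1 - x * q ^ (-((j : ℤ) + 1))))⁻¹ := rfl

theorem qPoch_natCast_succ (q x : ℂ) (n : ℕ) :
    qPoch q x ((n + 1 : ℕ) : ℤ) = qPoch q x n * (1 - x * q ^ n) := by
  simp only [qPoch_natCast, Finset.prod_range_succ]

theorem qPoch_natCast_add (q x : ℂ) (i j : ℕ) :
    qPoch q x ((i + j : ℕ) : ℤ) = qPoch q x i * qPoch q (x * q ^ i) j := by
  simp only [qPoch_natCast, Finset.prod_range_add, pow_add, mul_assoc]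

theorem qPoch_natCast_succ' (q x : ℂ) (n : ℕ) :
    qPoch q x ((n + 1 : ℕ) : ℤ) = (1 - x) * qPoch q (x * q) n := by
  rw [add_comm n 1, qPoch_natCast_add, qPoch_natCast q x 1]
  simp

theorem qAdmissible.one_sub_ne_zero {q x : ℂ} (hx : qAdmissible q x) (n : ℕ) :
    1 - x * q ^ n ≠ 0 := by
  intro h
  apply hx n
  rw [zpow_neg, zpow_natCast]
  exact eq_inv_of_mul_eq_one_left (sub_eq_zero.mp h).symm

theorem qAdmissible_of_one_sub_ne_zero {q x : ℂ} (hq : q ≠ 0) (hx : ∀ n : ℕ, 1 - x * q ^ n ≠ 0) :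
    qAdmissible q x := by
  intro k h
  apply hx k
  rw [h, zpow_neg, zpow_natCast, inv_mul_cancel₀ (pow_ne_zero _ hq), sub_self]

theorem qAdmissible.mul_pow {q x : ℂ} (hq : q ≠ 0) (hx : qAdmissible q x) (n : ℕ) :
    qAdmissible q (x * q ^ n) :=
  qAdmissible_of_one_sub_ne_zero hq fun k => by
    rw [mul_assoc, ← pow_add]
    exact hx.one_sub_ne_zero _

theorem qAdmissible_self {q : ℂ} (hq : q ≠ 0) (hq1 : ‖q‖ < 1) : qAdmissible q q :=
  qAdmissible_of_one_sub_ne_zero hq fun k h => by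
    have h1 : ‖q ^ (k + 1)‖ < 1 := by
      rw [norm_pow]
      exact pow_lt_one₀ (norm_nonneg _) hq1 (Nat.succ_ne_zero k)
    rw [pow_succ', ← sub_eq_zero.mp h] at h1
    simp at h1

theorem qPoch_natCast_ne_zero {q x : ℂ} (hx : qAdmissible q x) (n : ℕ) :
    qPoch q x (n : ℤ) ≠ 0 := by
  rw [qPoch_natCast]
  exact Finset.prod_ne_zero_iff.mpr fun j _ => hx.one_sub_ne_zero j

theorem summable_norm_mul_pow {q : ℂ} (hq1 : ‖q‖ < 1) (x : ℂ) :
    Summable fun j : ℕ => ‖-(x * q ^ j)‖ := by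
  simp only [norm_neg, norm_mul, norm_pow]
  exact (summable_geometric_of_lt_one (norm_nonneg _) hq1).mul_left _

theorem multipliable_one_sub_mul_pow {q : ℂ} (hq1 : ‖q‖ < 1) (x : ℂ) :
    Multipliable fun j : ℕ => 1 - x * q ^ j := by
  simpa only [sub_eq_add_neg] using multipliable_one_add_of_summable (summable_norm_mul_pow hq1 x)

theorem tendsto_qPoch {q : ℂ} (hq1 : ‖q‖ < 1) (x : ℂ) :
    Tendsto (fun n : ℕ => qPoch q x n) atTop (𝓝 (qPochInf q x)) :=
  (multipliable_one_sub_mul_pow hq1 x).hasProd.tendsto_prod_nat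

theorem qPochInf_ne_zero {q x : ℂ} (hq1 : ‖q‖ < 1) (hx : qAdmissible q x) :
    qPochInf q x ≠ 0 := by
  have := tprod_one_add_ne_zero_of_summable (f := fun j : ℕ => -(x * q ^ j))
    (fun j => by simpa only [← sub_eq_add_neg] using hx.one_sub_ne_zero j)
    (summable_norm_mul_pow hq1 x)
  simpa only [← sub_eq_add_neg, qPochInf] using this

theorem qPochInf_eq_mul {q : ℂ} (hq1 : ‖q‖ < 1) (x : ℂ) (n : ℕ) :
    qPochInf q x = qPoch q x n * qPochInf q (x * q ^ n) := by
  have h1 := (tendsto_qPoch hq1 x).comp (tendsto_add_atTop_nat n)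
  have h2 := (tendsto_qPoch hq1 (x * q ^ n)).const_mul (qPoch q x n)
  refine tendsto_nhds_unique h1 (h2.congr fun k => ?_)
  rw [← qPoch_natCast_add, add_comm]
  rfl

theorem qPochInf_eq_one_sub_mul {q : ℂ} (hq1 : ‖q‖ < 1) (x : ℂ) :
    qPochInf q x = (1 - x) * qPochInf q (x * q) := by
  have := qPochInf_eq_mul hq1 x 1
  rw [qPoch_natCast] at this
  simpa using this

theorem qPochInf_zpow_neg {q : ℂ} (hq : q ≠ 0) (hq1 : ‖q‖ < 1) (k : ℕ) :
    qPochInf q (q ^ (-(k : ℤ))) = 0 := by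
  rw [qPochInf_eq_mul hq1 _ k, zpow_neg, zpow_natCast, inv_mul_cancel₀ (pow_ne_zero _ hq),
    qPochInf_eq_one_sub_mul hq1]
  simp

theorem qPoch_zpow_neg_eq_zero {q : ℂ} (hq : q ≠ 0) {k i : ℕ} (h : k < i) :
    qPoch q (q ^ (-(k : ℤ))) (i : ℤ) = 0 := by
  rw [qPoch_natCast]
  refine Finset.prod_eq_zero (Finset.mem_range.mpr h) ?_
  rw [zpow_neg, zpow_natCast, inv_mul_cancel₀ (pow_ne_zero _ hq), sub_self]

theorem tendsto_pow_zero {q : ℂ} (hq1 : ‖q‖ < 1) : Tendsto (fun n : ℕ => q ^ n) atTop (𝓝 0) :=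
  tendsto_pow_atTop_nhds_zero_of_norm_lt_one hq1

/-! ### Absolute convergence -/

theorem summable_mul_pow_of_tendsto {u : ℕ → ℂ} {L x : ℂ} (hu : Tendsto u atTop (𝓝 L))
    (hx : ‖x‖ < 1) : Summable fun i => u i * x ^ i := by
  obtain ⟨C, hC⟩ := (Metric.isBounded_range_of_tendsto u hu).exists_norm_le
  refine Summable.of_norm_bounded
    ((summable_geometric_of_lt_one (norm_nonneg _) hx).mul_left C) fun i => ?_
  rw [norm_mul, norm_pow]
  exact mul_le_mul_of_nonneg_right (hC _ ⟨i, rfl⟩) (by positivity)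

theorem tendsto_qPoch_div {q : ℂ} (hq : q ≠ 0) (hq1 : ‖q‖ < 1) (a : ℂ) :
    Tendsto (fun i : ℕ => qPoch q a i / qPoch q q i) atTop
      (𝓝 (qPochInf q a / qPochInf q q)) :=
  (tendsto_qPoch hq1 a).div (tendsto_qPoch hq1 q)
    (qPochInf_ne_zero hq1 (qAdmissible_self hq hq1))

theorem summable_qHypTerm {q : ℂ} (hq : q ≠ 0) (hq1 : ‖q‖ < 1) {r : ℕ} (a : ℂ) (b c : Fin r → ℂ)
    (hc : ∀ k, qAdmissible q (c k)) {x : ℂ} (hx : ‖x‖ < 1) : Summable (qHypTerm q a b c x) := by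
  refine summable_mul_pow_of_tendsto (u := fun i : ℕ =>
    (qPoch q a i * ∏ k, qPoch q (b k) i) / (qPoch q q i * ∏ k, qPoch q (c k) i)) (Tendsto.div
      ((tendsto_qPoch hq1 a).mul (tendsto_finsetProd _ fun k _ => tendsto_qPoch hq1 (b k)))
      ((tendsto_qPoch hq1 q).mul (tendsto_finsetProd _ fun k _ => tendsto_qPoch hq1 (c k)))
      (mul_ne_zero (qPochInf_ne_zero hq1 (qAdmissible_self hq hq1))
        (Finset.prod_ne_zero_iff.mpr fun k _ => qPochInf_ne_zero hq1 (hc k)))) hx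

/-! ### The `q`-binomial theorem and a case of the `q`-Gauss sum -/

theorem qPoch_div_succ_mul {q : ℂ} (hq : q ≠ 0) (hq1 : ‖q‖ < 1) (a : ℂ) (i : ℕ) :
    qPoch q a ((i + 1 : ℕ) : ℤ) / qPoch q q ((i + 1 : ℕ) : ℤ) * (1 - q ^ (i + 1)) =
      qPoch q a i / qPoch q q i * (1 - a * q ^ i) := by
  have h1 := qPoch_natCast_ne_zero (qAdmissible_self hq hq1) i
  have h2 := (qAdmissible_self hq hq1).one_sub_ne_zero i
  rw [qPoch_natCast_succ, qPoch_natCast_succ, pow_succ']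
  rw [div_mul_eq_mul_div, div_mul_eq_mul_div, mul_div_mul_right _ _ h2]

/-- The `q`-binomial theorem `∑ (a)_i / (q)_i t^i = (a t)_∞ / (t)_∞`. Both sides satisfy
`(1 - t) f(t) = (1 - a t) f(t q)`, which is iterated until the argument `t q ^ n` reaches `0`. -/
theorem qPochInf_mul_tsum_qBinomial {q : ℂ} (hq : q ≠ 0) (hq1 : ‖q‖ < 1) (a : ℂ) {t : ℂ}
    (ht : ‖t‖ < 1) :
    qPochInf q t * ∑' i : ℕ, qPoch q a i / qPoch q q i * t ^ i = qPochInf q (a * t) := by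
  set f : ℂ → ℂ := fun t => ∑' i : ℕ, qPoch q a i / qPoch q q i * t ^ i with hf
  have hsum : ∀ t : ℂ, ‖t‖ < 1 → Summable fun i : ℕ => qPoch q a i / qPoch q q i * t ^ i :=
    fun t ht => summable_mul_pow_of_tendsto (tendsto_qPoch_div hq hq1 a) ht
  have hle : ∀ t : ℂ, ‖t‖ < 1 → ∀ n : ℕ, ‖t * q ^ n‖ ≤ ‖t‖ := fun t _ n => by
    rw [norm_mul, norm_pow]
    exact mul_le_of_le_one_right (norm_nonneg _) (pow_le_one₀ (norm_nonneg _) hq1.le)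
  have hrec : ∀ t : ℂ, ‖t‖ < 1 → (1 - t) * f t = (1 - a * t) * f (t * q) := by
    intro t ht
    have htq : ‖t * q‖ < 1 := lt_of_le_of_lt (by simpa using hle t ht 1) ht
    have h1 : f t - f (t * q) = t * (f t - a * f (t * q)) := by
      simp only [hf]
      rw [← tsum_mul_left (a := a), ← (hsum t ht).tsum_sub (hsum _ htq),
        ← (hsum t ht).tsum_sub ((hsum _ htq).mul_left a), ← tsum_mul_left,
        ((hsum t ht).sub (hsum _ htq)).tsum_eq_zero_add]
      simp only [pow_zero, sub_self, zero_add]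
      refine tsum_congr fun i => ?_
      linear_combination t ^ (i + 1) * qPoch_div_succ_mul hq hq1 a i
    linear_combination h1
  have hiter : ∀ n : ℕ, qPoch q t n * f t = qPoch q (a * t) n * f (t * q ^ n) := by
    intro n
    induction n with
    | zero => simp [qPoch_zero]
    | succ n ih =>
      rw [qPoch_natCast_succ, qPoch_natCast_succ]
      have := hrec (t * q ^ n) ((hle t ht n).trans_lt ht)
      rw [mul_assoc t, ← pow_succ] at this
      linear_combination (1 - t * q ^ n) * ih + qPoch q (a * t) n * this
  have hlim : Tendsto (fun n : ℕ => f (t * q ^ n)) atTop (𝓝 1) := by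
    have h0 : ∑' i : ℕ, qPoch q a i / qPoch q q i * (0 : ℂ) ^ i = 1 := by
      rw [tsum_eq_single 0 fun i hi => by simp [hi]]
      simp [qPoch_zero]
    rw [← h0]
    refine tendsto_tsum_of_dominated_convergence (hsum t ht).norm (fun i => ?_)
      (Eventually.of_forall fun n i => ?_)
    · have := (tendsto_pow_zero hq1).const_mul t
      rw [mul_zero] at this
      exact (this.pow i).const_mul _
    · rw [norm_mul, norm_mul, norm_pow, norm_pow]
      gcongr
      exact hle t ht n
  have hL := (tendsto_qPoch hq1 t).mul_const (f t)
  have hR := (tendsto_qPoch hq1 (a * t)).mul hlim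
  rw [mul_one] at hR
  exact tendsto_nhds_unique hL (hR.congr fun n => (hiter n).symm)

theorem tendsto_one_sub_mul_pow {q : ℂ} (hq1 : ‖q‖ < 1) (x : ℂ) :
    Tendsto (fun i : ℕ => 1 - x * q ^ i) atTop (𝓝 1) := by
  simpa using ((tendsto_pow_zero hq1).const_mul x).const_sub 1

theorem summable_qGauss {q : ℂ} (hq : q ≠ 0) (hq1 : ‖q‖ < 1) (a x : ℂ) {t : ℂ} (ht : ‖t‖ < 1) :
    Summable fun i : ℕ => qPoch q a i / qPoch q q i * t ^ i / (1 - x * q ^ i) := by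
  refine (summable_mul_pow_of_tendsto ((tendsto_qPoch_div hq hq1 a).div
    (tendsto_one_sub_mul_pow hq1 x) one_ne_zero) ht).congr fun i => ?_
  simp only [Pi.div_apply]
  ring

/-- The `q`-Gauss sum `₂φ₁(a, x; x q; q, q / a)`, written without the factor `1 - x`. Iterating
`(1 - x) S(x) = (1 - x q / a) S(x q)` moves `x` to `0`, where the `q`-binomial theorem applies. -/
theorem qPochInf_mul_tsum_qGauss {q : ℂ} (hq : q ≠ 0) (hq1 : ‖q‖ < 1) {a x : ℂ} (ha : a ≠ 0)
    (hqa : ‖q / a‖ < 1) (hx : qAdmissible q x) :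
    qPochInf q (q / a) * (qPochInf q x *
      ∑' i : ℕ, qPoch q a i / qPoch q q i * (q / a) ^ i / (1 - x * q ^ i)) =
      qPochInf q q * qPochInf q (x * q / a) := by
  set S : ℂ → ℂ := fun x =>
    ∑' i : ℕ, qPoch q a i / qPoch q q i * (q / a) ^ i / (1 - x * q ^ i) with hS
  set P : ℂ := ∑' i : ℕ, qPoch q a i / qPoch q q i * (q / a) ^ i with hP
  have hsP : Summable fun i : ℕ => qPoch q a i / qPoch q q i * (q / a) ^ i :=
    summable_mul_pow_of_tendsto (tendsto_qPoch_div hq hq1 a) hqa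
  have hrec : ∀ x, qAdmissible q x → (1 - x) * S x = (1 - x * (q / a)) * S (x * q) := by
    intro x hx
    have hx0 := hx.one_sub_ne_zero
    have hsx := summable_qGauss hq hq1 a x hqa
    have hsxq := summable_qGauss hq hq1 a (x * q) hqa
    have hs1 : Summable fun i : ℕ =>
        qPoch q a i / qPoch q q i * (q / a) ^ i * (1 - q ^ i) / (1 - x * q ^ i) := by
      rcases eq_or_ne x 0 with rfl | h0
      · refine (hsP.sub (summable_mul_pow_of_tendsto (x := q / a * q)
          (tendsto_qPoch_div hq hq1 a) ?_)).congr fun i => ?_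
        · rw [norm_mul]
          exact mul_lt_one_of_nonneg_of_lt_one_left (norm_nonneg _) hqa hq1.le
        · simp only [zero_mul, sub_zero, div_one, mul_pow]
          ring
      · refine ((hsP.mul_left x⁻¹).sub (hsx.mul_left (x⁻¹ - 1))).congr fun i => ?_
        have := hx0 i
        field_simp
        ring
    have e1 : (1 - x) * S x = P - x * ∑' i : ℕ,
        qPoch q a i / qPoch q q i * (q / a) ^ i * (1 - q ^ i) / (1 - x * q ^ i) := by
      rw [hS, hP, ← tsum_mul_left, ← tsum_mul_left, ← hsP.tsum_sub (hs1.mul_left x)]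
      refine tsum_congr fun i => ?_
      have := hx0 i
      field_simp
      ring
    rw [e1, hs1.tsum_eq_zero_add]
    simp only [pow_zero, sub_self, mul_zero, zero_div, zero_add]
    have hs2 := (summable_nat_add_iff 1).mpr hs1
    rw [hS, hP, ← tsum_mul_left, ← tsum_mul_left, ← hsP.tsum_sub (hs2.mul_left x)]
    refine tsum_congr fun i => ?_
    have h1 := hx0 (i + 1)
    have h2 : 1 - x * q * q ^ i ≠ 0 := by rwa [mul_assoc, ← pow_succ']
    have h3 := qPoch_div_succ_mul hq hq1 a i
    rw [mul_right_comm, h3]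
    rw [show 1 - x * q ^ (i + 1) = 1 - x * q * q ^ i by ring]
    have : (q / a) * a = q := by field_simp
    generalize qPoch q a i / qPoch q q i = e
    generalize q / a = t at *
    generalize hd : 1 - x * q * q ^ i = d at h2
    field_simp
    linear_combination -e * t ^ i * hd + x * q ^ i * e * t ^ i * this
  have hiter : ∀ n : ℕ, qPoch q x n * S x = qPoch q (x * (q / a)) n * S (x * q ^ n) := by
    intro n
    induction n with
    | zero => simp [qPoch_zero]
    | succ n ih =>
      rw [qPoch_natCast_succ, qPoch_natCast_succ]
      have := hrec (x * q ^ n) (hx.mul_pow hq n)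
      rw [mul_assoc x (q ^ n) q, ← pow_succ] at this
      linear_combination (1 - x * q ^ n) * ih + qPoch q (x * (q / a)) n * this
  have hlim : Tendsto (fun n : ℕ => S (x * q ^ n)) atTop (𝓝 P) := by
    -- `1 - x q ^ k` stays away from zero, which bounds the terms uniformly in `n`.
    obtain ⟨C, hC⟩ := (Metric.isBounded_range_of_tendsto _
      ((tendsto_one_sub_mul_pow hq1 x).inv₀ one_ne_zero)).exists_norm_le
    refine tendsto_tsum_of_dominated_convergence (hsP.norm.mul_right C) (fun i => ?_)
      (Eventually.of_forall fun n i => ?_)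
    · have h0 := ((tendsto_one_sub_mul_pow hq1 (x * q ^ i)).inv₀ one_ne_zero).const_mul
        (qPoch q a i / qPoch q q i * (q / a) ^ i)
      rw [inv_one, mul_one] at h0
      refine h0.congr fun n => ?_
      rw [mul_right_comm x, ← div_eq_mul_inv]
    · rw [div_eq_mul_inv, norm_mul]
      refine mul_le_mul_of_nonneg_left ?_ (norm_nonneg _)
      rw [mul_assoc x, ← pow_add]
      exact hC _ ⟨n + i, rfl⟩
  have hL := (tendsto_qPoch hq1 x).mul_const (S x)
  have hR := (tendsto_qPoch hq1 (x * (q / a))).mul hlim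
  have h1 := tendsto_nhds_unique hL (hR.congr fun n => (hiter n).symm)
  have h2 := qPochInf_mul_tsum_qBinomial hq hq1 a hqa
  rw [mul_div_cancel₀ _ ha] at h2
  rw [h1, mul_div_assoc]
  linear_combination qPochInf q (x * (q / a)) * h2

/-! ### Summation of rational functions by partial fractions -/

/-- The linear functional `G ↦ ∑ (a)_l / (q)_l a^(-l) G(q^(-l))` on functions of `w = q^(-l)`. -/
noncomputable def qBinomialSum (q a : ℂ) (G : ℂ → ℂ) : ℂ :=
  ∑' l : ℕ, qPoch q a l / qPoch q q l * a⁻¹ ^ l * G (q⁻¹ ^ l)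

theorem qAdmissible_of_norm_lt_one {q x : ℂ} (hq : q ≠ 0) (hq1 : ‖q‖ < 1) (hx : ‖x‖ < 1) :
    qAdmissible q x :=
  qAdmissible_of_one_sub_ne_zero hq fun n h => by
    have h1 : ‖x * q ^ n‖ < 1 := by
      rw [norm_mul, norm_pow]
      exact mul_lt_one_of_nonneg_of_lt_one_left (norm_nonneg _) hx
        (pow_le_one₀ (norm_nonneg _) hq1.le)
    rw [← sub_eq_zero.mp h] at h1
    simp at h1

/-- The functional kills `w^k`: the sum is `(q^(-k))_∞ / (q^(-k) / a)_∞ = 0`. -/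
theorem hasSum_qBinomial_pow {q a : ℂ} (hq : q ≠ 0) (hq1 : ‖q‖ < 1) (ha : a ≠ 0) {k : ℕ}
    (hk : ‖a⁻¹ * q⁻¹ ^ k‖ < 1) :
    HasSum (fun l : ℕ => qPoch q a l / qPoch q q l * a⁻¹ ^ l * (q⁻¹ ^ l) ^ k) 0 := by
  have h1 := (summable_mul_pow_of_tendsto (tendsto_qPoch_div hq hq1 a) hk).hasSum
  have h2 := qPochInf_mul_tsum_qBinomial hq hq1 a hk
  rw [mul_inv_cancel_left₀ ha, inv_pow, ← zpow_natCast, ← zpow_neg, qPochInf_zpow_neg hq hq1,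
    zpow_neg, zpow_natCast, ← inv_pow] at h2
  rw [(mul_eq_zero.mp h2).resolve_left
    (qPochInf_ne_zero hq1 (qAdmissible_of_norm_lt_one hq hq1 hk))] at h1
  refine h1.congr_fun fun l => ?_
  rw [mul_pow, ← pow_mul, ← pow_mul, mul_comm k, mul_assoc]

theorem hasSum_qBinomial_eval {q a : ℂ} (hq : q ≠ 0) (hq1 : ‖q‖ < 1) (ha : a ≠ 0)
    (d : Polynomial ℂ) (hd : ‖a⁻¹ * q⁻¹ ^ d.natDegree‖ < 1) :
    HasSum (fun l : ℕ => qPoch q a l / qPoch q q l * a⁻¹ ^ l * d.eval (q⁻¹ ^ l)) 0 := by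
  have h1 : ∀ k ∈ Finset.range (d.natDegree + 1), HasSum (fun l : ℕ =>
      d.coeff k * (qPoch q a l / qPoch q q l * a⁻¹ ^ l * (q⁻¹ ^ l) ^ k)) (d.coeff k * 0) := by
    intro k hk
    refine (hasSum_qBinomial_pow hq hq1 ha (lt_of_le_of_lt ?_ hd)).mul_left _
    rw [norm_mul, norm_mul, norm_pow, norm_pow]
    have : 1 ≤ ‖q⁻¹‖ := by
      rw [norm_inv]
      exact (one_le_inv₀ (norm_pos_iff.mpr hq)).mpr hq1.le
    exact mul_le_mul_of_nonneg_left
      (pow_le_pow_right₀ this (Nat.lt_succ_iff.mp (Finset.mem_range.mp hk))) (norm_nonneg _)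
  have h2 := hasSum_sum h1
  simp only [mul_zero, Finset.sum_const_zero] at h2
  refine h2.congr_fun fun l => ?_
  rw [Polynomial.eval_eq_sum_range, Finset.mul_sum]
  exact Finset.sum_congr rfl fun k _ => by ring

theorem hasSum_qBinomial_inv_sub {q a x : ℂ} (hq : q ≠ 0) (hq1 : ‖q‖ < 1) (ha : a ≠ 0)
    (hqa : ‖q / a‖ < 1) (hx : qAdmissible q x) :
    HasSum (fun l : ℕ => qPoch q a l / qPoch q q l * a⁻¹ ^ l * (q⁻¹ ^ l - x)⁻¹)
      (qPochInf q q * qPochInf q (x * q / a) / (qPochInf q (q / a) * qPochInf q x)) := by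
  have h1 := (summable_qGauss hq hq1 a x hqa).hasSum
  have h2 := qPochInf_mul_tsum_qGauss hq hq1 ha hqa hx
  have h3 := qPochInf_ne_zero hq1 (qAdmissible_of_norm_lt_one hq hq1 hqa)
  have h4 := qPochInf_ne_zero hq1 hx
  have h5 : ∑' i : ℕ, qPoch q a i / qPoch q q i * (q / a) ^ i / (1 - x * q ^ i) =
      qPochInf q q * qPochInf q (x * q / a) / (qPochInf q (q / a) * qPochInf q x) := by
    rw [eq_div_iff (mul_ne_zero h3 h4), ← h2]
    ring
  rw [h5] at h1
  refine h1.congr_fun fun l => ?_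
  have h6 := hx.one_sub_ne_zero l
  have h7 : q⁻¹ ^ l - x = (1 - x * q ^ l) / q ^ l := by
    rw [inv_pow]
    field_simp
  rw [h7, inv_div, div_pow, inv_pow]
  field_simp

theorem injOn_mul_pow {q b : ℂ} (hq : q ≠ 0) (hq1 : ‖q‖ < 1) (hb : b ≠ 0) (s : Set ℕ) :
    Set.InjOn (fun j : ℕ => b * q ^ j) s := by
  intro i _ j _ h
  have h1 := congrArg norm (mul_left_cancel₀ hb h)
  rw [norm_pow, norm_pow] at h1
  exact (pow_right_strictAnti₀ (norm_pos_iff.mpr hq) hq1).injective h1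

theorem inv_pow_sub_ne_zero {q b : ℂ} (hq : q ≠ 0) (hb : qAdmissible q b) (l j : ℕ) :
    q⁻¹ ^ l ≠ b * q ^ j := by
  intro h
  refine (hb.mul_pow hq j) l ?_
  rw [← h, zpow_neg, zpow_natCast, inv_pow]

/-- Partial fractions with nodes `b q^j`, `j < M`: the polynomial part contributes nothing, by the
`q`-binomial theorem, and the simple poles are `q`-Gauss sums. -/
theorem hasSum_qBinomial_eval_div_nodal {q a b : ℂ} (hq : q ≠ 0) (hq1 : ‖q‖ < 1) (ha : a ≠ 0)
    (hb0 : b ≠ 0) (hqa : ‖q / a‖ < 1) (hb : qAdmissible q b) (M : ℕ) (p : Polynomial ℂ)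
    (hp : ‖q‖ ^ M < ‖a‖ * ‖q‖ ^ p.natDegree) :
    HasSum (fun l : ℕ => qPoch q a l / qPoch q q l * a⁻¹ ^ l *
        (p.eval (q⁻¹ ^ l) /
          (Lagrange.nodal (Finset.range M) fun j : ℕ => b * q ^ j).eval (q⁻¹ ^ l)))
      (∑ j ∈ Finset.range M,
        Lagrange.nodalWeight (Finset.range M) (fun j : ℕ => b * q ^ j) j * p.eval (b * q ^ j) *
        (qPochInf q q * qPochInf q (b * q ^ j * q / a) /
          (qPochInf q (q / a) * qPochInf q (b * q ^ j)))) := by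
  set v : ℕ → ℂ := fun j => b * q ^ j with hv
  set N := Lagrange.nodal (Finset.range M) v with hN
  have hmonic : N.Monic := Lagrange.nodal_monic
  have hinj : Set.InjOn v (Finset.range M) := injOn_mul_pow hq hq1 hb0 _
  have hdecomp : p = Lagrange.interpolate (Finset.range M) v (fun j => p.eval (v j)) +
      N * (p /ₘ N) := by
    conv_lhs => rw [← Polynomial.modByMonic_add_div p N]
    congr 1
    refine Lagrange.eq_interpolate_of_eval_eq _ hinj ?_ fun j hj => ?_
    · rw [← Lagrange.degree_nodal (s := Finset.range M) (v := v)]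
      exact Polynomial.degree_modByMonic_lt _ hmonic
    · conv_rhs => rw [← Polynomial.modByMonic_add_div p N]
      rw [Polynomial.eval_add, Polynomial.eval_mul, hN, Lagrange.eval_nodal_at_node hj]
      simp
  have hpoly : HasSum (fun l : ℕ => qPoch q a l / qPoch q q l * a⁻¹ ^ l *
      (p /ₘ N).eval (q⁻¹ ^ l)) 0 := by
    by_cases hd : p /ₘ N = 0
    · simp [hd, hasSum_zero]
    · refine hasSum_qBinomial_eval hq hq1 ha _ ?_
      have hle : M ≤ p.natDegree := by
        by_contra hlt
        refine hd ((Polynomial.divByMonic_eq_zero_iff hmonic).mpr ?_)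
        rw [hN, Lagrange.degree_nodal, Finset.card_range]
        exact Polynomial.degree_le_natDegree.trans_lt (by exact_mod_cast not_le.mp hlt)
      obtain ⟨k, hk⟩ := Nat.exists_eq_add_of_le hle
      rw [Polynomial.natDegree_divByMonic _ hmonic, hN, Lagrange.natDegree_nodal,
        Finset.card_range, hk, Nat.add_sub_cancel_left]
      rw [hk, pow_add] at hp
      have hq0 : 0 < ‖q‖ := norm_pos_iff.mpr hq
      have ha0 : 0 < ‖a‖ := norm_pos_iff.mpr ha
      have h1 : 1 < ‖a‖ * ‖q‖ ^ k := by
        have : 0 < ‖q‖ ^ M := by positivity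
        nlinarith
      rw [norm_mul, norm_pow, norm_inv, norm_inv, inv_pow, ← mul_inv]
      exact inv_lt_one_of_one_lt₀ h1
  have hpoles := hasSum_sum fun j (_ : j ∈ Finset.range M) =>
    (hasSum_qBinomial_inv_sub hq hq1 ha hqa (hb.mul_pow hq j)).mul_left
      (Lagrange.nodalWeight (Finset.range M) v j * p.eval (v j))
  have hall := hpoles.add hpoly
  rw [add_zero] at hall
  refine hall.congr_fun fun l => ?_
  have hne : ∀ j ∈ Finset.range M, q⁻¹ ^ l ≠ v j := fun j _ => inv_pow_sub_ne_zero hq hb l j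
  have hN0 : N.eval (q⁻¹ ^ l) ≠ 0 := Lagrange.eval_nodal_not_at_node hne
  conv_lhs => rw [hdecomp]
  rw [Polynomial.eval_add, Lagrange.eval_interpolate_not_at_node _ hne, Polynomial.eval_mul,
    ← mul_add, mul_div_cancel_left₀ _ hN0, mul_add, Finset.mul_sum]
  congr 1
  exact Finset.sum_congr rfl fun j _ => by ring

/-- Passing from `a` to `a q` multiplies the summand by a linear polynomial in `w`. -/
theorem one_sub_mul_qBinomialSum {q a : ℂ} (hq : q ≠ 0) (G : ℂ → ℂ) :
    (1 - a) * qBinomialSum q (a * q) G = qBinomialSum q a fun w => (w - a) * G w := by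
  rw [qBinomialSum, qBinomialSum, ← tsum_mul_left]
  refine tsum_congr fun l => ?_
  have h1 := (qPoch_natCast_succ' q a l).symm.trans (qPoch_natCast_succ q a l)
  have h2 : (1 - a * q ^ l) * q⁻¹ ^ l = q⁻¹ ^ l - a := by
    rw [inv_pow]
    field_simp
  rw [mul_inv, mul_pow]
  linear_combination (a⁻¹ ^ l * q⁻¹ ^ l * G (q⁻¹ ^ l) / qPoch q q l) * h1 +
    qPoch q a l / qPoch q q l * a⁻¹ ^ l * G (q⁻¹ ^ l) * h2

/-- The partial fraction evaluation for every `a` for which the series converges. The restriction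
`|q / a| < 1` is removed by stepping from `a` to `a q`; keeping the factor `(q / a)_∞` on the left
avoids dividing by zero when `a` is a positive power of `q`. -/
theorem qPochInf_mul_qBinomialSum_nodal {q b : ℂ} (hq : q ≠ 0) (hq1 : ‖q‖ < 1)
    (hb0 : b ≠ 0) (hb : qAdmissible q b) (M : ℕ) {a : ℂ} (ha : a ≠ 0) (p : Polynomial ℂ) (D : ℕ)
    (hD : p.natDegree ≤ D) (hp : ‖q‖ ^ M < ‖a‖ * ‖q‖ ^ D) :
    qPochInf q (q / a) * qBinomialSum q a (fun w =>
        p.eval w / (Lagrange.nodal (Finset.range M) fun j : ℕ => b * q ^ j).eval w) =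
      qPochInf q q * ∑ j ∈ Finset.range M,
        Lagrange.nodalWeight (Finset.range M) (fun j : ℕ => b * q ^ j) j * p.eval (b * q ^ j) *
        (qPochInf q (b * q ^ j * q / a) / qPochInf q (b * q ^ j)) := by
  have hq0 : 0 < ‖q‖ := norm_pos_iff.mpr hq
  obtain ⟨n, hn⟩ : ∃ n : ℕ, ‖q‖ ^ (n + 1) < ‖a‖ := by
    obtain ⟨n, hn⟩ := exists_pow_lt_of_lt_one (norm_pos_iff.mpr ha) hq1
    exact ⟨n, (pow_le_pow_of_le_one hq0.le hq1.le n.le_succ).trans_lt hn⟩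
  induction n generalizing a p D with
  | zero =>
    have hqa : ‖q / a‖ < 1 := by
      rw [norm_div, div_lt_one (norm_pos_iff.mpr ha)]
      simpa using hn
    have h3 := qPochInf_ne_zero hq1 (qAdmissible_of_norm_lt_one hq hq1 hqa)
    rw [qBinomialSum, (hasSum_qBinomial_eval_div_nodal hq hq1 ha hb0 hqa hb M p
      (hp.trans_le ?_)).tsum_eq, Finset.mul_sum, Finset.mul_sum]
    · refine Finset.sum_congr rfl fun j _ => ?_
      field_simp
    · exact mul_le_mul_of_nonneg_left (pow_le_pow_of_le_one hq0.le hq1.le hD) (norm_nonneg _)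
  | succ n ih =>
    obtain ⟨a, rfl⟩ : ∃ a', a = a' * q := ⟨a / q, (div_mul_cancel₀ a hq).symm⟩
    have ha' : a ≠ 0 := left_ne_zero_of_mul ha
    have hn' : ‖q‖ ^ (n + 1) < ‖a‖ := by
      rw [norm_mul, pow_succ] at hn
      exact lt_of_mul_lt_mul_right hn hq0.le
    have hp' : ‖q‖ ^ M < ‖a‖ * ‖q‖ ^ (D + 1) := by
      rwa [norm_mul, mul_assoc, ← pow_succ'] at hp
    have hD' : ((Polynomial.X - Polynomial.C a) * p).natDegree ≤ D + 1 := by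
      refine Polynomial.natDegree_mul_le.trans ?_
      rw [Polynomial.natDegree_X_sub_C]
      omega
    have h1 := ih ha' ((Polynomial.X - Polynomial.C a) * p) (D + 1) hD' hp' hn'
    simp only [Polynomial.eval_mul, Polynomial.eval_sub, Polynomial.eval_X, Polynomial.eval_C,
      mul_div_assoc] at h1
    rw [← one_sub_mul_qBinomialSum hq] at h1
    have h2 : ∀ v : ℂ, qPochInf q (v * q / (a * q)) = -a⁻¹ * ((v - a) * qPochInf q (v * q / a)) :=
      fun v => by
        have : 1 - v / a = -a⁻¹ * (v - a) := by
          field_simp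
          ring
        rw [mul_div_mul_right _ _ hq, qPochInf_eq_one_sub_mul hq1 (v / a), this, div_mul_eq_mul_div,
          mul_assoc]
    have h3 := h2 1
    rw [one_mul] at h3
    rw [h3]
    simp only [h2]
    calc _ = -a⁻¹ * (qPochInf q (q / a) * ((1 - a) * qBinomialSum q (a * q) fun w => p.eval w /
          (Lagrange.nodal (Finset.range M) fun j : ℕ => b * q ^ j).eval w)) := by
            rw [mul_assoc, mul_assoc, mul_left_comm (1 - a)]
      _ = _ := by
        rw [h1, Finset.mul_sum, Finset.mul_sum, Finset.mul_sum]
        refine Finset.sum_congr rfl fun j _ => ?_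
        rw [mul_div_assoc (b * q ^ j) q a]
        ring

/-! ### Integer indices and the base `q⁻¹` -/

theorem qPoch_neg_natCast (q x : ℂ) (n : ℕ) :
    qPoch q x (-(n : ℤ)) = (∏ j ∈ Finset.range n, (1 - x * q ^ (-((j : ℤ) + 1))))⁻¹ := by
  cases n with
  | zero => simp [qPoch_zero]
  | succ n => exact qPoch_negSucc q x n

/-- Reversing the order of the factors. -/
theorem qPoch_mul_zpow_one_sub {q : ℂ} (hq : q ≠ 0) (x : ℂ) (k : ℤ) :
    qPoch q (x * q ^ (1 - k)) k = qPoch q⁻¹ x k := by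
  obtain ⟨n, rfl | rfl⟩ := k.eq_nat_or_neg
  · rw [qPoch_natCast, qPoch_natCast, ← Finset.prod_range_reflect]
    refine Finset.prod_congr rfl fun j hj => ?_
    have hj' := Finset.mem_range.mp hj
    rw [mul_assoc, ← zpow_natCast q, ← zpow_add₀ hq, inv_pow, ← zpow_natCast, ← zpow_neg]
    congr 3
    omega
  · rw [qPoch_neg_natCast, qPoch_neg_natCast, ← Finset.prod_range_reflect]
    congr 1
    refine Finset.prod_congr rfl fun j hj => ?_
    have hj' := Finset.mem_range.mp hj
    rw [mul_assoc, ← zpow_add₀ hq, inv_zpow, ← zpow_neg]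
    congr 3
    omega

theorem one_sub_mul_qPoch_mul {p x : ℂ} (hp : p ≠ 0) (k : ℤ) (h0 : 1 - x ≠ 0)
    (hk : 1 - x * p ^ k ≠ 0) :
    (1 - x) * qPoch p (x * p) k = qPoch p x k * (1 - x * p ^ k) := by
  obtain ⟨n, rfl | rfl⟩ := k.eq_nat_or_neg
  · rw [← qPoch_natCast_succ', qPoch_natCast_succ, zpow_natCast]
  · cases n with
    | zero => simp [qPoch_zero]
    | succ n =>
      rw [qPoch_neg_natCast, qPoch_neg_natCast, Finset.prod_range_succ', Finset.prod_range_succ]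
      have h1 : ∀ j : ℕ, 1 - x * p * p ^ (-(((j + 1 : ℕ) : ℤ) + 1)) =
          1 - x * p ^ (-((j : ℤ) + 1)) := fun j => by
        rw [mul_assoc, ← zpow_one_add₀ hp]
        congr 3
      have h2 : 1 - x * p * p ^ (-(((0 : ℕ) : ℤ) + 1)) = 1 - x := by
        simp [hp]
      have h3 : -((n : ℤ) + 1) = -((n + 1 : ℕ) : ℤ) := by push_cast; ring
      rw [h2, h3, mul_inv, mul_inv, Finset.prod_congr rfl fun j _ => h1 j]
      field_simp

theorem qPoch_add_natCast {p x : ℂ} (hp : p ≠ 0) (k : ℤ) (i : ℕ)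
    (h : ∀ t : ℤ, k ≤ t → t < 0 → 1 - x * p ^ t ≠ 0) :
    qPoch p x (k + i) = qPoch p x k * qPoch p (x * p ^ k) i := by
  have hsucc : ∀ t : ℤ, k ≤ t → qPoch p x (t + 1) = qPoch p x t * (1 - x * p ^ t) := by
    intro t ht
    obtain ⟨n, rfl | rfl⟩ := t.eq_nat_or_neg
    · exact_mod_cast qPoch_natCast_succ p x n
    · cases n with
      | zero => exact_mod_cast qPoch_natCast_succ p x 0
      | succ n =>
        have h1 := h _ ht (by omega)
        rw [show -((n + 1 : ℕ) : ℤ) + 1 = -(n : ℤ) by push_cast; ring, qPoch_neg_natCast,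
          qPoch_neg_natCast, Finset.prod_range_succ, mul_inv,
          show -((n : ℤ) + 1) = -((n + 1 : ℕ) : ℤ) by push_cast; ring, mul_assoc,
          inv_mul_cancel₀ h1, mul_one]
  induction i with
  | zero => simp [qPoch_zero]
  | succ i ih =>
    rw [qPoch_natCast_succ, ← mul_assoc, ← ih, Nat.cast_succ, ← add_assoc, hsucc _ (by omega),
      zpow_add₀ hp, zpow_natCast, ← mul_assoc]

theorem one_sub_inv_eq {x : ℂ} (hx : x ≠ 0) : 1 - x⁻¹ = -x⁻¹ * (1 - x) := by
  field_simp
  ring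

theorem qPoch_inv_base_ne_zero {q x : ℂ} (hq : q ≠ 0) (hx0 : x ≠ 0) {k : ℤ} (hx : qAdmissible q x)
    (hxk : qAdmissible q (x * q ^ k)) : qPoch q⁻¹ x⁻¹ k ≠ 0 := by
  obtain ⟨n, rfl | rfl⟩ := k.eq_nat_or_neg
  · rw [qPoch_natCast, Finset.prod_ne_zero_iff]
    intro j _
    rw [inv_pow, ← mul_inv, one_sub_inv_eq (mul_ne_zero hx0 (pow_ne_zero _ hq))]
    exact mul_ne_zero (neg_ne_zero.mpr (inv_ne_zero (mul_ne_zero hx0 (pow_ne_zero _ hq))))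
      (hx.one_sub_ne_zero j)
  · rw [qPoch_neg_natCast]
    refine inv_ne_zero (Finset.prod_ne_zero_iff.mpr fun j hj => ?_)
    have hj' := Finset.mem_range.mp hj
    have hxj : x * q ^ (-((j : ℤ) + 1)) ≠ 0 := mul_ne_zero hx0 (zpow_ne_zero _ hq)
    rw [inv_zpow, ← mul_inv, one_sub_inv_eq hxj]
    refine mul_ne_zero (neg_ne_zero.mpr (inv_ne_zero hxj)) ?_
    have h1 := hxk.one_sub_ne_zero (n - 1 - j)
    rw [mul_assoc, ← zpow_natCast, ← zpow_add₀ hq] at h1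
    convert h1 using 4
    omega

/-- The quotient `(x q^k)_j / (x)_j` as a quotient of shifted factorials of the fixed length `k`:
it depends on `j` only through `q^(-j)`. -/
theorem qPoch_mul_qPoch_inv_base {q x : ℂ} (hq : q ≠ 0) (hx0 : x ≠ 0) {k : ℤ}
    (hx : qAdmissible q x) (hxk : qAdmissible q (x * q ^ k)) (j : ℕ) :
    qPoch q x j * qPoch q⁻¹ (x * q ^ j)⁻¹ k * (q ^ k) ^ j =
      qPoch q (x * q ^ k) j * qPoch q⁻¹ x⁻¹ k := by
  induction j with
  | zero => simp [qPoch_zero]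
  | succ j ih =>
    have hq' := zpow_ne_zero k hq
    have hy : x * q ^ j ≠ 0 := mul_ne_zero hx0 (pow_ne_zero _ hq)
    have hyk : x * q ^ j * q ^ k ≠ 0 := mul_ne_zero hy hq'
    have h1 := hx.one_sub_ne_zero j
    have h2 : 1 - x * q ^ j * q ^ k ≠ 0 := by
      rw [mul_right_comm]
      exact hxk.one_sub_ne_zero j
    have h4 : 1 - (x * q ^ j)⁻¹ * q⁻¹ ^ k = -(x * q ^ j * q ^ k)⁻¹ * (1 - x * q ^ j * q ^ k) := by
      rw [inv_zpow, ← mul_inv, one_sub_inv_eq hyk]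
    have h3 := one_sub_mul_qPoch_mul (inv_ne_zero hq) (x := (x * q ^ j)⁻¹) k
      (by
        rw [one_sub_inv_eq hy]
        exact mul_ne_zero (neg_ne_zero.mpr (inv_ne_zero hy)) h1)
      (by
        rw [h4]
        exact mul_ne_zero (neg_ne_zero.mpr (inv_ne_zero hyk)) h2)
    rw [h4, one_sub_inv_eq hy, ← mul_inv, mul_assoc x, ← pow_succ] at h3
    rw [qPoch_natCast_succ, qPoch_natCast_succ, pow_succ (q ^ k)]
    have h5 : x * q ^ k * q ^ j = x * q ^ j * q ^ k := by ring
    rw [h5]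
    have h6 : (1 - x * q ^ j) * qPoch q⁻¹ (x * q ^ (j + 1))⁻¹ k * q ^ k =
        qPoch q⁻¹ (x * q ^ j)⁻¹ k * (1 - x * q ^ j * q ^ k) := by
      generalize qPoch q⁻¹ (x * q ^ (j + 1))⁻¹ k = A at *
      generalize qPoch q⁻¹ (x * q ^ j)⁻¹ k = B at *
      generalize x * q ^ j = y at *
      have h7 : y * y⁻¹ = 1 := mul_inv_cancel₀ hy
      have h8 : (y * q ^ k) * (y * q ^ k)⁻¹ = 1 := mul_inv_cancel₀ hyk
      linear_combination -(y * q ^ k) * h3 - (1 - y) * A * q ^ k * h7 + B * (1 - y * q ^ k) * h8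
    linear_combination qPoch q x j * (q ^ k) ^ j * h6 + (1 - x * q ^ j * q ^ k) * ih

theorem qPoch_zpow_neg_self_ne_zero {q : ℂ} (hq : q ≠ 0) (hq1 : ‖q‖ < 1) {m j : ℕ} (h : j ≤ m) :
    qPoch q (q ^ (-(m : ℤ))) (j : ℤ) ≠ 0 := by
  rw [qPoch_natCast, Finset.prod_ne_zero_iff]
  intro t ht
  have ht' := Finset.mem_range.mp ht
  obtain ⟨u, hu⟩ := Nat.exists_eq_add_of_lt (ht'.trans_le h)
  have h1 : q ^ (-(m : ℤ)) * q ^ t = (q * q ^ u)⁻¹ := by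
    rw [← pow_succ', ← zpow_natCast q t, ← zpow_add₀ hq, ← zpow_natCast, ← zpow_neg]
    congr 1
    push_cast [hu]
    ring
  have h2 : q * q ^ u ≠ 0 := mul_ne_zero hq (pow_ne_zero _ hq)
  rw [h1, one_sub_inv_eq h2]
  exact mul_ne_zero (neg_ne_zero.mpr (inv_ne_zero h2))
    ((qAdmissible_self hq hq1).one_sub_ne_zero u)

theorem qPoch_zpow_neg_self {q : ℂ} (hq : q ≠ 0) (k : ℕ) :
    qPoch q (q ^ (-(k : ℤ))) (k : ℤ) = ∏ t ∈ Finset.range k, (1 - (q ^ (t + 1))⁻¹) := by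
  rw [qPoch_natCast, ← Finset.prod_range_reflect]
  refine Finset.prod_congr rfl fun t ht => ?_
  have ht' := Finset.mem_range.mp ht
  rw [← zpow_natCast q (k - 1 - t), ← zpow_add₀ hq, ← zpow_natCast, ← zpow_neg]
  congr 2
  omega

/-- The residue of `1 / (w / b; q⁻¹)_(m + 1)` at its pole `w = b q^j`. -/
theorem prod_mul_nodalWeight {q b : ℂ} (hq : q ≠ 0) (hq1 : ‖q‖ < 1) (hb : b ≠ 0) {m j : ℕ}
    (hj : j ≤ m) :
    (∏ t ∈ Finset.range (m + 1), -(b * q ^ t)) *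
        Lagrange.nodalWeight (Finset.range (m + 1)) (fun j : ℕ => b * q ^ j) j =
      -b / qPoch q (q ^ (-(m : ℤ))) m * (q ^ j * (qPoch q (q ^ (-(m : ℤ))) j / qPoch q q j)) := by
  obtain ⟨k, rfl⟩ := Nat.exists_eq_add_of_le hj
  have hmem : j ∈ Finset.range (j + k + 1) := by simp
  rw [Lagrange.nodalWeight, ← Finset.mul_prod_erase _ _ hmem, mul_assoc, ← Finset.prod_mul_distrib]
  have h1 : ∀ t ∈ (Finset.range (j + k + 1)).erase j, -(b * q ^ t) * (b * q ^ j - b * q ^ t)⁻¹ =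
      if t = j then 1 else (1 - q ^ ((j : ℤ) - t))⁻¹ := by
    intro t ht
    have htj := (Finset.mem_erase.mp ht).1
    have hne : b * q ^ j ≠ b * q ^ t := fun h =>
      htj (injOn_mul_pow hq hq1 hb Set.univ (Set.mem_univ _) (Set.mem_univ _) h).symm
    have ht0 : b * q ^ t ≠ 0 := mul_ne_zero hb (pow_ne_zero _ hq)
    rw [if_neg htj, zpow_sub₀ hq, zpow_natCast, zpow_natCast, ← div_eq_mul_inv, ← mul_div_mul_left
      (q ^ j) (q ^ t) hb, one_sub_div ht0, inv_div, ← neg_sub (b * q ^ t), neg_div_neg_eq]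
  rw [Finset.prod_congr rfl h1, Finset.prod_erase (a := j)
    (f := fun t : ℕ => if t = j then (1 : ℂ) else (1 - q ^ ((j : ℤ) - t))⁻¹) _ (if_pos rfl), add_right_comm,
    Finset.prod_range_add, Finset.prod_range_succ, if_pos rfl, mul_one]
  have h2 : ∏ t ∈ Finset.range j, (if t = j then 1 else (1 - q ^ ((j : ℤ) - t))⁻¹) =
      (qPoch q q j)⁻¹ := by
    rw [qPoch_natCast, ← Finset.prod_inv_distrib, ← Finset.prod_range_reflect]
    refine Finset.prod_congr rfl fun t ht => ?_
    have ht' := Finset.mem_range.mp ht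
    rw [if_neg (by omega), ← pow_succ', ← zpow_natCast]
    congr 3
    omega
  have h3 : ∏ t ∈ Finset.range k, (if j + 1 + t = j then 1 else
      (1 - q ^ ((j : ℤ) - (j + 1 + t : ℕ)))⁻¹) = (qPoch q (q ^ (-(k : ℤ))) k)⁻¹ := by
    rw [qPoch_zpow_neg_self hq, ← Finset.prod_inv_distrib]
    refine Finset.prod_congr rfl fun t _ => ?_
    rw [if_neg (by omega), ← zpow_natCast, ← zpow_neg]
    congr 3
    omega
  have h4 : q ^ (-((j + k : ℕ) : ℤ)) * q ^ j = q ^ (-(k : ℤ)) := by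
    rw [← zpow_natCast q j, ← zpow_add₀ hq]
    congr 1
    push_cast
    ring
  have h5 := qPoch_zpow_neg_self_ne_zero hq hq1 hj
  have h6 := qPoch_zpow_neg_self_ne_zero hq hq1 le_rfl (m := k)
  have h7 := qPoch_natCast_ne_zero (qAdmissible_self hq hq1) j
  rw [h2, h3, qPoch_natCast_add, h4]
  field_simp

/-- Summation of `p(w) / (w / b; q⁻¹)_(m + 1)` with `p` a polynomial in `w`, for every integer `m`.
For `m < 0` the summand is a polynomial in `w`, and the right-hand side is an empty sum. -/
theorem qPochInf_mul_qBinomialSum_div {q a b : ℂ} (hq : q ≠ 0) (hq1 : ‖q‖ < 1)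
    (ha : a ≠ 0) (hb0 : b ≠ 0) (hb : qAdmissible q b) (m : ℤ) (p : Polynomial ℂ) (D : ℤ)
    (hD : (p.natDegree : ℤ) ≤ D) (hp : ‖a⁻¹ * q ^ (m + 1 - D)‖ < 1) :
    qPochInf q (q / a) * qBinomialSum q a (fun w => p.eval w / qPoch q⁻¹ (w * b⁻¹) (m + 1)) =
      -b * qPochInf q q / qPoch q (q ^ (-m)) m * ∑ j ∈ Finset.range (m + 1).toNat,
        q ^ j * (qPoch q (q ^ (-m)) j / qPoch q q j) * p.eval (b * q ^ j) *
        (qPochInf q (b * q ^ j * q / a) / qPochInf q (b * q ^ j)) := by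
  lift D to ℕ using (by omega)
  have hq0 : 0 < ‖q‖ := norm_pos_iff.mpr hq
  have ha0 : 0 < ‖a‖ := norm_pos_iff.mpr ha
  have hp' : ‖q‖ ^ (m + 1) < ‖a‖ * ‖q‖ ^ D := by
    rw [norm_mul, norm_inv, norm_zpow, zpow_sub₀ hq0.ne', zpow_natCast, inv_mul_eq_div, div_div,
      div_lt_one (by positivity), mul_comm] at hp
    exact hp
  obtain ⟨n, rfl | hm⟩ : ∃ n : ℕ, m = n ∨ m + 1 = -(n : ℤ) := by
    rcases le_or_gt 0 m with h | h
    · exact ⟨m.toNat, Or.inl (by omega)⟩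
    · exact ⟨(-(m + 1)).toNat, Or.inr (by omega)⟩
  · have h1 := qPochInf_mul_qBinomialSum_nodal hq hq1 hb0 hb (n + 1) ha p D
      (by exact_mod_cast hD) (by exact_mod_cast hp')
    have h2 : (fun w => p.eval w / qPoch q⁻¹ (w * b⁻¹) ((n : ℤ) + 1)) = fun w =>
        (∏ t ∈ Finset.range (n + 1), -(b * q ^ t)) * (p.eval w /
          (Lagrange.nodal (Finset.range (n + 1)) fun j : ℕ => b * q ^ j).eval w) := by
      funext w
      have h3 : qPoch q⁻¹ (w * b⁻¹) ((n : ℤ) + 1) =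
          (∏ t ∈ Finset.range (n + 1), -(b * q ^ t))⁻¹ *
          (Lagrange.nodal (Finset.range (n + 1)) fun j : ℕ => b * q ^ j).eval w := by
        rw [Lagrange.eval_nodal, ← Finset.prod_inv_distrib, ← Finset.prod_mul_distrib]
        refine (qPoch_natCast q⁻¹ (w * b⁻¹) (n + 1)).trans (Finset.prod_congr rfl fun t _ => ?_)
        rw [inv_pow]
        have := pow_ne_zero t hq
        field_simp
        ring
      rw [h3]
      generalize (∏ t ∈ Finset.range (n + 1), -(b * q ^ t)) = K
      rw [← div_div, div_inv_eq_mul]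
      ring
    have h4 : ((n : ℤ) + 1).toNat = n + 1 := by omega
    have h5 : ∀ (K : ℂ) (G : ℂ → ℂ), qBinomialSum q a (fun w => K * G w) =
        K * qBinomialSum q a G := fun K G => by
      rw [qBinomialSum, qBinomialSum, ← tsum_mul_left]
      exact tsum_congr fun l => by ring
    rw [h2, h5, mul_left_comm, h1, h4, Finset.mul_sum, Finset.mul_sum, Finset.mul_sum]
    refine Finset.sum_congr rfl fun j hj => ?_
    have h6 := prod_mul_nodalWeight hq hq1 hb0 (Nat.lt_succ_iff.mp (Finset.mem_range.mp hj))
    linear_combination qPochInf q q * p.eval (b * q ^ j) *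
        (qPochInf q (b * q ^ j * q / a) / qPochInf q (b * q ^ j)) * h6
  · rw [hm, zpow_neg, zpow_natCast, inv_lt_iff_one_lt_mul₀ (by positivity)] at hp'
    have h2 : (fun w => p.eval w / qPoch q⁻¹ (w * b⁻¹) (m + 1)) = fun w =>
        (p * ∏ j ∈ Finset.range n, (1 - Polynomial.C (b⁻¹ * q ^ (j + 1)) * Polynomial.X)).eval w /
          (Lagrange.nodal (Finset.range 0) fun j : ℕ => b * q ^ j).eval w := by
      funext w
      rw [hm, qPoch_neg_natCast, div_inv_eq_mul, Polynomial.eval_mul, Polynomial.eval_prod,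
        Lagrange.eval_nodal, Finset.range_zero, Finset.prod_empty, div_one]
      congr 1
      refine Finset.prod_congr rfl fun j _ => ?_
      have : q⁻¹ ^ (-((j : ℤ) + 1)) = q ^ (j + 1) := by
        rw [inv_zpow, ← zpow_neg, neg_neg]
        exact_mod_cast rfl
      rw [this]
      simp
      ring
    rw [h2, qPochInf_mul_qBinomialSum_nodal hq hq1 hb0 hb 0 ha _ (D + n), hm]
    · simp
    · refine Polynomial.natDegree_mul_le.trans (add_le_add (by exact_mod_cast hD) ?_)
      refine (Polynomial.natDegree_prod_le _ _).trans
        ((Finset.sum_le_card_nsmul _ _ 1 fun j _ => ?_).trans (by simp))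
      compute_degree
    · rw [pow_zero, pow_add]
      linarith

/-! ### Series on the left as values of the functional -/

/-- The polynomial `w ↦ (x w; q)_n`. -/
noncomputable def qPochPoly (q x : ℂ) (n : ℕ) : Polynomial ℂ :=
  ∏ t ∈ Finset.range n, (1 - Polynomial.C (x * q ^ t) * Polynomial.X)

theorem eval_qPochPoly (q x : ℂ) (n : ℕ) (w : ℂ) :
    (qPochPoly q x n).eval w = qPoch q (w * x) n := by
  rw [qPochPoly, Polynomial.eval_prod, qPoch_natCast]
  refine Finset.prod_congr rfl fun t _ => ?_
  simp
  ring

theorem natDegree_qPochPoly_le (q x : ℂ) (n : ℕ) : (qPochPoly q x n).natDegree ≤ n := by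
  refine (Polynomial.natDegree_prod_le _ _).trans
    ((Finset.sum_le_card_nsmul _ _ 1 fun t _ => ?_).trans (by simp))
  compute_degree

/-- Reversing the factors and extracting `-q^(-t) / x` from each of them. -/
theorem qPoch_inv_base_mul_pow {q x : ℂ} (hq : q ≠ 0) (hx : x ≠ 0) (n : ℕ) :
    qPoch q⁻¹ x⁻¹ n * x ^ n = (∏ t ∈ Finset.range n, -(q⁻¹ ^ t)) * qPoch q x n := by
  have hx' : x ^ n = ∏ _t ∈ Finset.range n, x := by simp
  rw [qPoch_natCast, qPoch_natCast, hx', ← Finset.prod_mul_distrib, ← Finset.prod_mul_distrib]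
  refine Finset.prod_congr rfl fun t _ => ?_
  rw [inv_pow]
  have := pow_ne_zero t hq
  field_simp
  ring

theorem prod_neg_inv_pow_ne_zero {q : ℂ} (hq : q ≠ 0) (n : ℕ) :
    ∏ t ∈ Finset.range n, -(q⁻¹ ^ t) ≠ 0 :=
  Finset.prod_ne_zero_iff.mpr fun _ _ => neg_ne_zero.mpr (pow_ne_zero _ (inv_ne_zero hq))

theorem qHypTerm_vecCons (q : ℂ) {r : ℕ} (a b d x : ℂ) (β γ : Fin r → ℂ) (i : ℕ) :
    qHypTerm q a (Matrix.vecCons b β) (Matrix.vecCons d γ) x i =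
      (qPoch q a i * (qPoch q b i * ∏ k, qPoch q (β k) i)) /
        (qPoch q q i * (qPoch q d i * ∏ k, qPoch q (γ k) i)) * x ^ i := by
  simp only [qHypTerm, Fin.prod_univ_succ, Matrix.cons_val_zero, Matrix.cons_val_succ]

theorem qAdmissible_vecCons {q : ℂ} {r : ℕ} {d : ℂ} {γ : Fin r → ℂ} (hd : qAdmissible q d)
    (hγ : ∀ k, qAdmissible q (γ k)) (k : Fin (r + 1)) :
    qAdmissible q (Matrix.vecCons d γ k) := by
  refine Fin.cases ?_ (fun k => ?_) k
  · simpa using hd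
  · simpa using hγ k

theorem qPoch_div_qPoch_mul_zpow {q x : ℂ} (hq : q ≠ 0) (hx0 : x ≠ 0) {k : ℤ}
    (hx : qAdmissible q x) (hxk : qAdmissible q (x * q ^ k)) (j : ℕ) :
    qPoch q x j / qPoch q (x * q ^ k) j =
      qPoch q⁻¹ x⁻¹ k / (qPoch q⁻¹ (q⁻¹ ^ j * x⁻¹) k * (q ^ k) ^ j) := by
  have h1 := qPoch_mul_qPoch_inv_base hq hx0 hx hxk j
  have h2 := qPoch_natCast_ne_zero hxk j
  have hj := pow_ne_zero j hq
  have h3 := qPoch_inv_base_ne_zero hq (mul_ne_zero hx0 hj) (k := k) (hx.mul_pow hq j)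
    (by rw [mul_right_comm]; exact hxk.mul_pow hq j)
  have h4 := pow_ne_zero j (zpow_ne_zero k hq)
  have h5 : q⁻¹ ^ j * x⁻¹ = (x * q ^ j)⁻¹ := by rw [inv_pow, mul_inv, mul_comm]
  rw [h5, div_eq_div_iff h2 (mul_ne_zero h3 h4), ← mul_assoc, h1, mul_comm]

/-- The left-hand summand of the first transformation as a summand of `qBinomialSum`; the powers
of `q` in the argument of the series combine to `w^s`. -/
theorem qHypTerm_eq_qBinomialSum_summand {q : ℂ} (hq : q ≠ 0) (m : ℤ) {r : ℕ} (n : Fin r → ℕ)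
    (s : ℕ) (a : ℂ) {b : ℂ} {c : Fin r → ℂ} (hb0 : b ≠ 0) (hc0 : ∀ k, c k ≠ 0)
    (hb : qAdmissible q b) (hbm : qAdmissible q (b * q ^ (m + 1)))
    (hc : ∀ k, qAdmissible q (c k)) (l : ℕ) :
    qHypTerm q a (Matrix.vecCons b (fun k => c k * q ^ n k))
        (Matrix.vecCons (b * q ^ (m + 1)) c) (a⁻¹ * q ^ (m + 1 - (∑ k, (n k : ℤ)) - (s : ℤ))) l =
      qPoch q⁻¹ b⁻¹ (m + 1) / (∏ k, qPoch q⁻¹ (c k)⁻¹ (n k)) *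
        (qPoch q a l / qPoch q q l * a⁻¹ ^ l * ((q⁻¹ ^ l) ^ s *
          (∏ k, qPoch q⁻¹ (q⁻¹ ^ l * (c k)⁻¹) (n k)) / qPoch q⁻¹ (q⁻¹ ^ l * b⁻¹) (m + 1))) := by
  have h1 := qPoch_div_qPoch_mul_zpow hq hb0 hb hbm l
  have hcn : ∀ k, qAdmissible q (c k * q ^ (n k : ℤ)) := fun k => by
    rw [zpow_natCast]
    exact (hc k).mul_pow hq _
  have h2 : ∏ k, qPoch q (c k) l / qPoch q (c k * q ^ (n k : ℤ)) l =
      ∏ k, (qPoch q⁻¹ (c k)⁻¹ (n k) / (qPoch q⁻¹ (q⁻¹ ^ l * (c k)⁻¹) (n k) * (q ^ (n k : ℤ)) ^ l)) :=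
    Finset.prod_congr rfl fun k _ => qPoch_div_qPoch_mul_zpow hq (hc0 k) (hc k) (hcn k) l
  simp only [zpow_natCast, Finset.prod_div_distrib, Finset.prod_mul_distrib, Finset.prod_pow] at h2
  have h3 := congrArg Inv.inv h2
  rw [inv_div, inv_div] at h3
  have h4 : (a⁻¹ * q ^ (m + 1 - (∑ k, (n k : ℤ)) - (s : ℤ))) ^ l =
      a⁻¹ ^ l * ((q ^ (m + 1)) ^ l * (q⁻¹ ^ l) ^ s / (∏ k, q ^ n k) ^ l) := by
    have h5 : q ^ (∑ k, (n k : ℤ)) = ∏ k, q ^ n k := by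
      rw [Finset.prod_pow_eq_pow_sum, ← zpow_natCast]
      push_cast
      rfl
    have h6 : (q⁻¹ ^ l) ^ s = ((q ^ s) ^ l)⁻¹ := by
      rw [inv_pow, inv_pow, ← pow_mul, ← pow_mul, mul_comm]
    rw [zpow_sub₀ hq, zpow_sub₀ hq, h5, zpow_natCast, mul_pow, div_pow, div_pow, h6]
    ring
  rw [qHypTerm_vecCons, h4]
  calc _ = qPoch q a l / qPoch q q l * a⁻¹ ^ l *
        (qPoch q b l / qPoch q (b * q ^ (m + 1)) l * (q ^ (m + 1)) ^ l) *
        ((∏ k, qPoch q (c k * q ^ n k) l) / (∏ k, qPoch q (c k) l) / (∏ k, q ^ n k) ^ l) *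
        (q⁻¹ ^ l) ^ s := by ring
    _ = _ := by
      rw [h1, h3]
      have h6 := pow_ne_zero l (zpow_ne_zero (m + 1) hq)
      have h7 : (∏ k, q ^ n k) ^ l ≠ 0 :=
        pow_ne_zero _ (Finset.prod_ne_zero_iff.mpr fun k _ => pow_ne_zero _ hq)
      have h8 : qPoch q⁻¹ b⁻¹ (m + 1) / (qPoch q⁻¹ (q⁻¹ ^ l * b⁻¹) (m + 1) * (q ^ (m + 1)) ^ l) *
          (q ^ (m + 1)) ^ l = qPoch q⁻¹ b⁻¹ (m + 1) / qPoch q⁻¹ (q⁻¹ ^ l * b⁻¹) (m + 1) := by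
        rw [div_mul_eq_mul_div, mul_div_mul_right _ _ h6]
      rw [h8, div_div, mul_div_mul_right _ _ h7]
      ring

/-- The shift `y ↦ y q^j` of a shifted factorial of fixed length `n`, as a quotient of shifted
factorials of length `j`. -/
theorem qPoch_inv_base_mul_pow_eq {q y : ℂ} (hq : q ≠ 0) (n j : ℕ)
    (hy : qAdmissible q (y * q ^ (1 - (n : ℤ)))) :
    qPoch q⁻¹ (y * q ^ j) n = qPoch q⁻¹ y n *
      (qPoch q (y * q) j / qPoch q (y * q ^ (1 - (n : ℤ))) j) := by
  have h1 := qPoch_natCast_ne_zero hy j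
  rw [← qPoch_mul_zpow_one_sub hq, ← qPoch_mul_zpow_one_sub hq, mul_div_assoc', eq_div_iff h1,
    mul_right_comm y, mul_comm, ← qPoch_natCast_add, add_comm j n, qPoch_natCast_add, mul_assoc y,
    ← zpow_natCast, ← zpow_add₀ hq, sub_add_cancel, zpow_one]

theorem qHyp_eq_sum_range {q : ℂ} (hq : q ≠ 0) {r : ℕ} (m : ℕ) (b c : Fin r → ℂ) (x : ℂ) :
    qHyp q (q ^ (-(m : ℤ))) b c x =
      ∑ j ∈ Finset.range (m + 1), qHypTerm q (q ^ (-(m : ℤ))) b c x j := by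
  refine tsum_eq_sum fun j hj => ?_
  rw [qHypTerm, qPoch_zpow_neg_eq_zero hq (by simpa using hj)]
  simp

theorem qPoch_self_eq_zero {q : ℂ} (hq : q ≠ 0) {m : ℤ} (hm : m < 0) : qPoch q q m = 0 := by
  obtain ⟨n, rfl⟩ := Int.eq_negSucc_of_lt_zero hm
  rw [qPoch_negSucc, inv_eq_zero]
  refine Finset.prod_eq_zero (Finset.mem_range.mpr n.succ_pos) ?_
  simp [hq]

theorem prod_qPoch_inv_base_div {q b : ℂ} (hq0 : q ≠ 0) (hb : b ≠ 0) {r : ℕ} (n : Fin r → ℕ)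
    {c : Fin r → ℂ} (hc : ∀ k, c k ≠ 0) (hcq : ∀ k, qAdmissible q (c k)) :
    (∏ k, qPoch q⁻¹ (b / c k) (n k)) / ∏ k, qPoch q⁻¹ (c k)⁻¹ (n k) =
      b ^ (∑ k, n k) * ((∏ k, qPoch q (c k / b) (n k)) / ∏ k, qPoch q (c k) (n k)) := by
  rw [← Finset.prod_div_distrib, ← Finset.prod_div_distrib, ← Finset.prod_pow_eq_pow_sum,
    ← Finset.prod_mul_distrib]
  refine Finset.prod_congr rfl fun k _ => ?_
  have h1 := qPoch_inv_base_mul_pow hq0 (hc k) (n k)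
  have h2 := qPoch_inv_base_mul_pow hq0 (div_ne_zero (hc k) hb) (n k)
  have h3 := prod_neg_inv_pow_ne_zero hq0 (n k)
  have h4 := qPoch_natCast_ne_zero (hcq k) (n k)
  have h5 := pow_ne_zero (n k) (hc k)
  have h6 := pow_ne_zero (n k) hb
  rw [inv_div, div_pow, mul_div_assoc', div_eq_iff h6] at h2
  rw [← eq_div_iff h5] at h1 h2
  rw [h1, h2]
  generalize ∏ t ∈ Finset.range (n k), -(q⁻¹ ^ t) = κ at h3
  field_simp

/-- Evaluation of the constant in front of the residue sum; the products `∏ -q^(-t)` that come from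
reversing shifted factorials cancel. -/
theorem qPoch_inv_base_div_qPochInf {q b : ℂ} (hq0 : q ≠ 0) (hq1 : ‖q‖ < 1) (hb : b ≠ 0)
    (hb1 : qAdmissible q b) (m : ℕ) :
    qPoch q⁻¹ b⁻¹ ((m : ℤ) + 1) * (-b) / qPoch q (q ^ (-(m : ℤ))) m / qPochInf q b =
      qPoch q (b * q) m / (b ^ m * qPochInf q (b * q) * qPoch q q m) := by
  have hb_inf := qPochInf_ne_zero hq1 hb1
  have h1 := qPoch_natCast_succ' q⁻¹ b⁻¹ m
  have h2 := qPoch_inv_base_mul_pow hq0 (mul_ne_zero hb hq0) m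
  have h3 := qPoch_inv_base_mul_pow hq0 hq0 m
  have h4 := prod_neg_inv_pow_ne_zero hq0 m
  have h5 := qPoch_natCast_ne_zero (qAdmissible_self hq0 hq1) m
  have h6 := pow_ne_zero m hb
  have h7 := pow_ne_zero m hq0
  have h8 : qPoch q (q ^ (-(m : ℤ))) m = qPoch q⁻¹ q⁻¹ m := by
    rw [← qPoch_mul_zpow_one_sub hq0, ← zpow_neg_one, ← zpow_add₀ hq0]
    congr 2
    ring
  rw [mul_pow, mul_inv] at h2
  rw [← eq_div_iff (mul_ne_zero h6 h7)] at h2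
  rw [← eq_div_iff h7] at h3
  rw [h8, h3, show (m : ℤ) + 1 = ((m + 1 : ℕ) : ℤ) by push_cast; rfl, h1, h2, one_sub_inv_eq hb,
    qPochInf_eq_one_sub_mul hq1 b]
  rw [qPochInf_eq_one_sub_mul hq1 b] at hb_inf
  have h9 := left_ne_zero_of_mul hb_inf
  have h10 := right_ne_zero_of_mul hb_inf
  generalize ∏ t ∈ Finset.range m, -(q⁻¹ ^ t) = κ at h4
  field_simp

theorem prod_qPoch_inv_base_mul_pow {q b : ℂ} (hq0 : q ≠ 0) {r : ℕ} (n : Fin r → ℕ)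
    {c : Fin r → ℂ} (hbc : ∀ k, qAdmissible q (b * q ^ (1 - (n k : ℤ)) / c k)) (j : ℕ) :
    ∏ k, qPoch q⁻¹ (b * q ^ j * (c k)⁻¹) (n k) = (∏ k, qPoch q⁻¹ (b / c k) (n k)) *
      ((∏ k, qPoch q (b * q / c k) j) / ∏ k, qPoch q (b * q ^ (1 - (n k : ℤ)) / c k) j) := by
  rw [← Finset.prod_div_distrib, ← Finset.prod_mul_distrib]
  refine Finset.prod_congr rfl fun k _ => ?_
  have h1 := qPoch_inv_base_mul_pow_eq hq0 (y := b / c k) (n k) j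
    (by rw [div_mul_eq_mul_div]; exact hbc k)
  rw [div_mul_eq_mul_div, div_mul_eq_mul_div, div_mul_eq_mul_div] at h1
  rw [← div_eq_mul_inv, h1]

/-! ### The first transformation -/

/-- The first transformation when `(b)_∞ ≠ 0`. The remaining case `b = 1` is degenerate, as both
series then consist of a single term. -/
theorem qHyp_transformation {q : ℂ} (hq0 : q ≠ 0) (hq1 : ‖q‖ < 1)
    (m : ℤ) {r : ℕ} (n : Fin r → ℕ) (s : ℕ) {a b : ℂ} {c : Fin r → ℂ}
    (ha : a ≠ 0) (hb : b ≠ 0) (hc : ∀ k, c k ≠ 0)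
    (hbm : qAdmissible q (b * q ^ (m + 1))) (hcq : ∀ k, qAdmissible q (c k))
    (hba : qAdmissible q (b * q / a))
    (hbc : ∀ k, qAdmissible q (b * q ^ (1 - (n k : ℤ)) / c k))
    (hqa : qAdmissible q (q / a)) (hb1 : qAdmissible q b)
    (hx : ‖a⁻¹ * q ^ (m + 1 - (∑ k, (n k : ℤ)) - (s : ℤ))‖ < 1) :
    qHyp q a
        (Matrix.vecCons b (fun k => c k * q ^ n k))
        (Matrix.vecCons (b * q ^ (m + 1)) c)
        (a⁻¹ * q ^ (m + 1 - (∑ k, (n k : ℤ)) - (s : ℤ)))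
      = (qPochInf q q * qPochInf q (b * q / a) * qPoch q (b * q) m
            * ∏ k, qPoch q (c k / b) (n k))
          / (qPochInf q (q / a) * qPochInf q (b * q) * qPoch q q m
            * ∏ k, qPoch q (c k) (n k))
        * b ^ ((∑ k, (n k : ℤ)) - m + (s : ℤ))
        * qHyp q (q ^ (-m))
            (Matrix.vecCons b (fun k => b * q / c k))
            (Matrix.vecCons (b * q / a) (fun k => b * q ^ (1 - (n k : ℤ)) / c k))
            (q ^ (1 + s)) := by
  set K := qPoch q⁻¹ b⁻¹ (m + 1) / ∏ k, qPoch q⁻¹ (c k)⁻¹ (n k) with hK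
  set p : Polynomial ℂ := Polynomial.X ^ s * ∏ k, qPochPoly q⁻¹ (c k)⁻¹ (n k) with hp
  have hpe : ∀ w, p.eval w = w ^ s * ∏ k, qPoch q⁻¹ (w * (c k)⁻¹) (n k) := fun w => by
    simp only [hp, Polynomial.eval_mul, Polynomial.eval_pow, Polynomial.eval_X,
      Polynomial.eval_prod, eval_qPochPoly]
  have hpd : (p.natDegree : ℤ) ≤ (∑ k, (n k : ℤ)) + s := by
    have h1 : p.natDegree ≤ s + ∑ k, n k := by
      refine Polynomial.natDegree_mul_le.trans (add_le_add (by simp) ?_)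
      exact (Polynomial.natDegree_prod_le _ _).trans
        (Finset.sum_le_sum fun k _ => natDegree_qPochPoly_le _ _ _)
    zify at h1
    linarith
  have hmain := qPochInf_mul_qBinomialSum_div hq0 hq1 ha hb hb1 m p _ hpd
    (by rwa [← sub_sub])
  have hL : qHyp q a (Matrix.vecCons b (fun k => c k * q ^ n k))
      (Matrix.vecCons (b * q ^ (m + 1)) c) (a⁻¹ * q ^ (m + 1 - (∑ k, (n k : ℤ)) - (s : ℤ))) =
      K * qBinomialSum q a fun w => p.eval w / qPoch q⁻¹ (w * b⁻¹) (m + 1) := by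
    rw [qHyp, qBinomialSum, ← tsum_mul_left]
    refine tsum_congr fun l => ?_
    rw [qHypTerm_eq_qBinomialSum_summand hq0 m n s a hb hc hb1 hbm hcq, hpe]
  have hqa0 := qPochInf_ne_zero hq1 hqa
  rw [hL]
  refine mul_left_cancel₀ hqa0 ?_
  rw [mul_left_comm, hmain]
  rcases lt_or_ge m 0 with hm | hm
  · rw [qPoch_self_eq_zero hq0 hm, Int.toNat_of_nonpos (by omega)]
    simp
  lift m to ℕ using hm
  rw [qHyp_eq_sum_range hq0, show ((m : ℤ) + 1).toNat = m + 1 by omega, Finset.mul_sum,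
    Finset.mul_sum, Finset.mul_sum, Finset.mul_sum]
  refine Finset.sum_congr rfl fun j hj => ?_
  rw [hpe, qHypTerm_vecCons]
  have e1 := prod_qPoch_inv_base_mul_pow hq0 n hbc j
  have e2 := prod_qPoch_inv_base_div hq0 hb n hc hcq
  have e3 := qPoch_inv_base_div_qPochInf hq0 hq1 hb hb1 m
  have e4 : qPochInf q (b * q / a) = qPoch q (b * q / a) j * qPochInf q (b * q ^ j * q / a) := by
    rw [qPochInf_eq_mul hq1 _ j]
    congr 2
    ring
  have e5 := qPochInf_eq_mul hq1 b j
  have e6 : b ^ ((∑ k, (n k : ℤ)) - m + (s : ℤ)) = b ^ (∑ k, n k) * b ^ s / b ^ m := by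
    rw [sub_add_eq_add_sub, zpow_sub₀ hb, zpow_add₀ hb, zpow_natCast, zpow_natCast, ← zpow_natCast b
      (∑ k, n k)]
    push_cast
    rfl
  have h1 := qPoch_natCast_ne_zero hba j
  have h2 : qPoch q b j ≠ 0 := qPoch_natCast_ne_zero hb1 j
  have e7 : (qPochInf q (b * q ^ j))⁻¹ = qPoch q b j / qPochInf q b := by
    rw [e5, ← div_div, div_self h2, one_div]
  calc _ = (qPoch q⁻¹ b⁻¹ ((m : ℤ) + 1) * (-b) / qPoch q (q ^ (-(m : ℤ))) m / qPochInf q b) *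
        ((∏ k, qPoch q⁻¹ (b / c k) (n k)) / ∏ k, qPoch q⁻¹ (c k)⁻¹ (n k)) *
        (qPochInf q q * q ^ j * (qPoch q (q ^ (-(m : ℤ))) j / qPoch q q j) * (b * q ^ j) ^ s *
        ((∏ k, qPoch q (b * q / c k) j) / ∏ k, qPoch q (b * q ^ (1 - (n k : ℤ)) / c k) j) *
          qPochInf q (b * q ^ j * q / a) * qPoch q b j) := by
        rw [e1, hK, div_eq_mul_inv (qPochInf q (b * q ^ j * q / a)), e7]
        generalize qPoch q⁻¹ b⁻¹ ((m : ℤ) + 1) = y0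
        generalize qPoch q (q ^ (-(m : ℤ))) m = y1
        generalize qPoch q (q ^ (-(m : ℤ))) j = y2
        generalize (∏ k, qPoch q⁻¹ (b / c k) (n k)) = y3
        generalize (∏ k, qPoch q⁻¹ (c k)⁻¹ (n k)) = y4
        generalize (∏ k, qPoch q (b * q / c k) j) = y5
        generalize (∏ k, qPoch q (b * q ^ (1 - (n k : ℤ)) / c k) j) = y6
        ring
    _ = _ := by
      rw [e2, e3, e6, e4, mul_pow, pow_add, pow_one, mul_pow, ← pow_mul, ← pow_mul, mul_comm j s]
      generalize qPochInf q (q / a) = A at hqa0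
      generalize qPoch q (b * q / a) j = B at h1
      generalize (∏ k, qPoch q (b * q / c k) j) = x1
      generalize (∏ k, qPoch q (b * q ^ (1 - (n k : ℤ)) / c k) j) = x2
      generalize (∏ k, qPoch q (c k / b) (n k)) = x3
      generalize (∏ k, qPoch q (c k) (n k)) = x4
      generalize qPoch q (q ^ (-(m : ℤ))) j = x5
      generalize qPoch q (b * q) m = x6
      generalize qPochInf q (b * q) = x7
      generalize qPochInf q (b * q ^ j * q / a) = x8
      generalize qPoch q q m = x9
      generalize qPoch q q j = x10
      generalize qPoch q b j = x11
      generalize qPochInf q q = x12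
      generalize b ^ m = x13
      have hAB : A * A⁻¹ * (B * B⁻¹) = 1 := by
        rw [mul_inv_cancel₀ hqa0, mul_inv_cancel₀ h1, one_mul]
      refine (one_mul _).symm.trans ?_
      rw [← hAB]
      ring

/-! ### Cancellation at infinity -/

/-- The terminating `q`-binomial theorem at `q^(l + 1)`, where the product side vanishes. -/
theorem sum_qPoch_zpow_neg_mul_pow {q : ℂ} (hq : q ≠ 0) (hq1 : ‖q‖ < 1) {s l : ℕ} (hl : l < s) :
    ∑ i ∈ Finset.range (s + 1),
      qPoch q (q ^ (-(s : ℤ))) i / qPoch q q i * q ^ i * (q ^ i) ^ l = 0 := by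
  have ht : ‖q ^ (l + 1)‖ < 1 := by
    rw [norm_pow]
    exact pow_lt_one₀ (norm_nonneg _) hq1 l.succ_ne_zero
  have h1 := qPochInf_mul_tsum_qBinomial hq hq1 (q ^ (-(s : ℤ))) ht
  have h2 : q ^ (-(s : ℤ)) * q ^ (l + 1) = q ^ (-((s - 1 - l : ℕ) : ℤ)) := by
    rw [← zpow_natCast q (l + 1), ← zpow_add₀ hq]
    congr 1
    omega
  rw [h2, qPochInf_zpow_neg hq hq1] at h1
  rw [← (mul_eq_zero.mp h1).resolve_left (qPochInf_ne_zero hq1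
    (qAdmissible_of_norm_lt_one hq hq1 ht)), tsum_eq_sum (s := Finset.range (s + 1)) fun i hi => ?_]
  · refine Finset.sum_congr rfl fun i _ => ?_
    rw [← pow_mul, ← pow_mul, mul_assoc, ← pow_add]
    congr 2
    ring
  · rw [qPoch_zpow_neg_eq_zero hq (by simpa using hi)]
    simp

/-- The formal power series `1 / (x w; q)_∞ = ∑ (x w)^l / (q)_l` in `w`. -/
noncomputable def qExpSeries (q x : ℂ) : PowerSeries ℂ :=
  PowerSeries.mk fun l => x ^ l / qPoch q q l

theorem constantCoeff_qExpSeries (q x : ℂ) :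
    PowerSeries.constantCoeff (qExpSeries q x) = 1 := by
  rw [← PowerSeries.coeff_zero_eq_constantCoeff_apply, qExpSeries, PowerSeries.coeff_mk]
  simp [qPoch_zero]

theorem rescale_qExpSeries {q : ℂ} (hq : q ≠ 0) (hq1 : ‖q‖ < 1) (x : ℂ) :
    PowerSeries.rescale q (qExpSeries q x) =
      (1 - PowerSeries.C x * PowerSeries.X) * qExpSeries q x := by
  ext l
  rw [sub_mul, one_mul, map_sub, mul_assoc, PowerSeries.coeff_C_mul, PowerSeries.coeff_rescale]
  cases l with
  | zero => simp
  | succ l =>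
    rw [PowerSeries.coeff_succ_X_mul, qExpSeries, PowerSeries.coeff_mk, PowerSeries.coeff_mk,
      qPoch_natCast_succ]
    have h1 := qPoch_natCast_ne_zero (qAdmissible_self hq hq1) l
    have h2 := (qAdmissible_self hq hq1).one_sub_ne_zero l
    generalize qPoch q q l = u at *
    rw [pow_succ x, pow_succ' q]
    generalize q * q ^ l = v at *
    field_simp
    ring

theorem coe_qPochPoly_mul_rescale {q : ℂ} (hq : q ≠ 0) (hq1 : ‖q‖ < 1) (x : ℂ) (i k : ℕ) :
    (qPochPoly q (x * q ^ i) k : PowerSeries ℂ) *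
        PowerSeries.rescale (q ^ i) (qExpSeries q x) =
      PowerSeries.rescale (q ^ (i + k)) (qExpSeries q x) := by
  induction k with
  | zero => simp [qPochPoly]
  | succ k ih =>
    have h1 := congrArg (PowerSeries.rescale (q ^ (i + k))) (rescale_qExpSeries hq hq1 x)
    rw [PowerSeries.rescale_rescale, ← pow_succ', map_mul, map_sub, map_one, map_mul,
      PowerSeries.rescale_X, ← ih] at h1
    have h2 : PowerSeries.rescale (q ^ (i + k)) (PowerSeries.C x) = PowerSeries.C x := by
      ext l
      rw [PowerSeries.coeff_rescale, PowerSeries.coeff_C]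
      split_ifs with h
      · simp [h]
      · simp
    rw [h2, ← mul_assoc (PowerSeries.C x), ← map_mul] at h1
    rw [← add_assoc, h1, qPochPoly, Finset.prod_range_succ, ← qPochPoly, Polynomial.coe_mul,
      Polynomial.coe_sub, Polynomial.coe_one, Polynomial.coe_mul, Polynomial.coe_C,
      Polynomial.coe_X, mul_assoc x, ← pow_add]
    ring

/-- Up to a factor independent of `i`, the product of shifted factorials below is `B(w q^i)` for a
single power series `B`. The coefficient of `w^l` therefore depends on `i` through `q^(i l)` only,
and summation against `(q^(-s))_i / (q)_i q^i` kills it for `l < s`. -/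
theorem X_pow_dvd_sum_qPochPoly {q : ℂ} (hq : q ≠ 0) (hq1 : ‖q‖ < 1) {r : ℕ} (x y : ℂ)
    (z : Fin r → ℂ) (n : Fin r → ℕ) {s : ℕ} (hs : ∀ k, s ≤ n k) :
    (Polynomial.X ^ s : Polynomial ℂ) ∣ ∑ i ∈ Finset.range (s + 1),
      Polynomial.C (qPoch q (q ^ (-(s : ℤ))) i / qPoch q q i * q ^ i) *
        (qPochPoly q x i * qPochPoly q y i * ∏ k, qPochPoly q (z k * q ^ i) (n k - i)) := by
  set c : ℕ → ℂ := fun i => qPoch q (q ^ (-(s : ℤ))) i / qPoch q q i * q ^ i with hc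
  set E : PowerSeries ℂ := qExpSeries q x * qExpSeries q y with hE
  set Γ : PowerSeries ℂ := ∏ k, qExpSeries q (z k) with hΓ
  have hΓ1 : PowerSeries.constantCoeff Γ ≠ 0 := by
    simp [hΓ, map_prod, constantCoeff_qExpSeries]
  have hΓ0 : Γ ≠ 0 := fun h => hΓ1 (by rw [h, map_zero])
  have hEu : IsUnit E := by
    rw [PowerSeries.isUnit_iff_constantCoeff, hE, map_mul, constantCoeff_qExpSeries,
      constantCoeff_qExpSeries]
    simp
  set B : PowerSeries ℂ := E * Γ⁻¹ with hB
  have hBΓ : B * Γ = E := by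
    rw [hB, mul_assoc, PowerSeries.inv_mul_cancel _ hΓ1, mul_one]
  set A : PowerSeries ℂ := ∏ k, PowerSeries.rescale (q ^ n k) (qExpSeries q (z k)) with hA
  have hterm : ∀ i ∈ Finset.range (s + 1),
      ((qPochPoly q x i * qPochPoly q y i * ∏ k, qPochPoly q (z k * q ^ i) (n k - i) :
        Polynomial ℂ) : PowerSeries ℂ) * E = A * PowerSeries.rescale (q ^ i) B := by
    intro i hi
    have his : i ≤ s := Nat.lt_succ_iff.mp (Finset.mem_range.mp hi)
    have hR0 : PowerSeries.rescale (q ^ i) Γ ≠ 0 := fun h =>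
      hΓ0 (PowerSeries.rescale_injective (pow_ne_zero i hq) (h.trans (map_zero _).symm))
    refine mul_right_cancel₀ hR0 ?_
    rw [mul_assoc A, ← map_mul, hBΓ]
    have hx := coe_qPochPoly_mul_rescale hq hq1 x 0 i
    have hy := coe_qPochPoly_mul_rescale hq hq1 y 0 i
    simp only [pow_zero, mul_one, PowerSeries.rescale_one, RingHom.id_apply, zero_add] at hx hy
    have hz : ((∏ k, qPochPoly q (z k * q ^ i) (n k - i) : Polynomial ℂ) : PowerSeries ℂ) *
        PowerSeries.rescale (q ^ i) Γ = A := by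
      rw [← Polynomial.coeToPowerSeries.ringHom_apply, map_prod, hΓ, map_prod, hA,
        ← Finset.prod_mul_distrib]
      refine Finset.prod_congr rfl fun k _ => ?_
      rw [Polynomial.coeToPowerSeries.ringHom_apply, coe_qPochPoly_mul_rescale hq hq1,
        Nat.add_sub_cancel' (his.trans (hs k))]
    rw [Polynomial.coe_mul, Polynomial.coe_mul, ← hz, hE, map_mul, ← hx, ← hy]
    ring
  have hdvd : (PowerSeries.X ^ s : PowerSeries ℂ) ∣
      ∑ i ∈ Finset.range (s + 1), PowerSeries.C (c i) * PowerSeries.rescale (q ^ i) B := by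
    rw [PowerSeries.X_pow_dvd_iff]
    intro l hl
    simp only [map_sum, PowerSeries.coeff_C_mul, PowerSeries.coeff_rescale]
    have h1 := sum_qPoch_zpow_neg_mul_pow hq hq1 hl
    simp only [← mul_assoc, ← Finset.sum_mul]
    rw [h1, zero_mul]
  have hprod : ((∑ i ∈ Finset.range (s + 1), Polynomial.C (c i) *
      (qPochPoly q x i * qPochPoly q y i * ∏ k, qPochPoly q (z k * q ^ i) (n k - i)) :
        Polynomial ℂ) : PowerSeries ℂ) * E =
      A * ∑ i ∈ Finset.range (s + 1), PowerSeries.C (c i) * PowerSeries.rescale (q ^ i) B := by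
    rw [← Polynomial.coeToPowerSeries.ringHom_apply, map_sum, Finset.sum_mul, Finset.mul_sum]
    refine Finset.sum_congr rfl fun i hi => ?_
    rw [map_mul, Polynomial.coeToPowerSeries.ringHom_apply,
      Polynomial.coeToPowerSeries.ringHom_apply, Polynomial.coe_C, mul_assoc, hterm i hi]
    ring
  have h1 := hEu.dvd_mul_right.mp (hprod ▸ hdvd.mul_left A)
  rw [PowerSeries.X_pow_dvd_iff] at h1
  rw [Polynomial.X_pow_dvd_iff]
  intro l hl
  rw [← Polynomial.coeff_coe]
  exact h1 l hl

/-! ### The summands of the second transformation -/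

theorem qPochInf_zpow_div_mul_qPoch {q a : ℂ} (hq : q ≠ 0) (hq1 : ‖q‖ < 1) (ha : a ≠ 0) (i j : ℕ) :
    qPochInf q (q ^ (1 - (i : ℤ)) / a) * qPoch q (a * q ^ i) j =
      (∏ t ∈ Finset.range i, -(q⁻¹ ^ t)) * a⁻¹ ^ i *
        (qPochInf q (q / a) * qPoch q a ((i + j : ℕ) : ℤ)) := by
  have h1 := qPoch_inv_base_mul_pow hq ha i
  rw [← qPoch_mul_zpow_one_sub hq] at h1
  have h2 : q ^ (1 - (i : ℤ)) / a * q ^ i = q / a := by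
    rw [div_mul_eq_mul_div, ← zpow_natCast q i, ← zpow_add₀ hq, sub_add_cancel, zpow_one]
  have h3 : a⁻¹ * q ^ (1 - (i : ℤ)) = q ^ (1 - (i : ℤ)) / a := by rw [mul_comm, div_eq_mul_inv]
  rw [h3, ← eq_div_iff (pow_ne_zero i ha)] at h1
  rw [qPochInf_eq_mul hq1 _ i, h2, h1, qPoch_natCast_add, inv_pow a]
  ring

theorem inv_qPoch_self_eq {q : ℂ} (hq : q ≠ 0) (hq1 : ‖q‖ < 1) (i j : ℕ) :
    (qPoch q q j)⁻¹ = qPoch q (q⁻¹ ^ (i + j)) i * q ^ ((j + 1) * i) /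
      ((∏ t ∈ Finset.range i, -(q⁻¹ ^ t)) * qPoch q q ((i + j : ℕ) : ℤ)) := by
  have h1 := qPoch_inv_base_mul_pow hq (pow_ne_zero (j + 1) hq) i
  have h2 : (q ^ (j + 1))⁻¹ * q ^ (1 - (i : ℤ)) = q⁻¹ ^ (i + j) := by
    rw [inv_pow, ← zpow_natCast, ← zpow_natCast, ← zpow_neg, ← zpow_neg, ← zpow_add₀ hq]
    congr 1
    push_cast
    ring
  rw [← qPoch_mul_zpow_one_sub hq, h2, ← pow_mul] at h1
  have h3 := qPoch_natCast_ne_zero (qAdmissible_self hq hq1) j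
  have h4 := qPoch_natCast_ne_zero (qAdmissible_self hq hq1) (i + j)
  have h5 := prod_neg_inv_pow_ne_zero hq i
  rw [add_comm i j, qPoch_natCast_add, ← pow_succ'] at h4
  have h6 := right_ne_zero_of_mul h4
  rw [add_comm i j, qPoch_natCast_add, ← pow_succ', ← add_comm i j, h1]
  generalize ∏ t ∈ Finset.range i, -(q⁻¹ ^ t) = κ at *
  generalize qPoch q (q ^ (j + 1)) i = u at *
  generalize qPoch q q j = v at *
  field_simp

theorem qPoch_zpow_div_eq {q x : ℂ} (hq : q ≠ 0) (e : ℤ) (i : ℕ) :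
    qPoch q (q ^ (1 - e) / x) (e - i) = qPoch q⁻¹ (x * q ^ i)⁻¹ (e - i) := by
  rw [← qPoch_mul_zpow_one_sub hq, mul_inv, div_eq_mul_inv, mul_comm, mul_assoc, ← zpow_natCast,
    ← zpow_neg, ← zpow_add₀ hq]
  congr 3
  ring

theorem numerator_factor_eq {q c : ℂ} (hq : q ≠ 0) (hc0 : c ≠ 0) (hc : qAdmissible q c)
    {i n : ℕ} (hi : i ≤ n) (j : ℕ) :
    qPoch q (q ^ (1 - (n : ℤ)) / c) ((n : ℤ) - i) *
        (qPoch q (c * q ^ n) j / qPoch q (c * q ^ i) j) =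
      (qPochPoly q (q ^ (1 - (n : ℤ)) / c * q ^ i) (n - i)).eval (q⁻¹ ^ (i + j)) *
        (q ^ (n - i)) ^ j := by
  have hci0 : c * q ^ i ≠ 0 := mul_ne_zero hc0 (pow_ne_zero _ hq)
  have hci := hc.mul_pow hq i
  have hcn : c * q ^ i * q ^ ((n - i : ℕ) : ℤ) = c * q ^ n := by
    rw [zpow_natCast, mul_assoc, ← pow_add, Nat.add_sub_cancel' hi]
  have h1 := qPoch_div_qPoch_mul_zpow hq hci0 (k := ((n - i : ℕ) : ℤ)) hci
    (by rw [hcn]; exact hc.mul_pow hq n) j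
  have h2 : q⁻¹ ^ (i + j) * (q ^ (1 - (n : ℤ)) / c * q ^ i) =
      q⁻¹ ^ j * (c * q ^ i)⁻¹ * q ^ (1 - ((n - i : ℕ) : ℤ)) := by
    have h3 : q ^ (1 - ((n - i : ℕ) : ℤ)) = q ^ (1 - (n : ℤ)) * q ^ i := by
      rw [← zpow_natCast q i, ← zpow_add₀ hq]
      congr 1
      omega
    have h4 := pow_ne_zero i hq
    rw [h3, pow_add, inv_pow]
    field_simp
  have h5 : qPoch q⁻¹ (c * q ^ i)⁻¹ ((n - i : ℕ) : ℤ) ≠ 0 :=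
    qPoch_inv_base_ne_zero hq hci0 hci (by rw [hcn]; exact hc.mul_pow hq n)
  rw [hcn] at h1
  rw [qPoch_zpow_div_eq hq, eval_qPochPoly, h2, qPoch_mul_zpow_one_sub hq, ← Nat.cast_sub hi,
    ← inv_div (qPoch q (c * q ^ i) j), h1, zpow_natCast, inv_div,
    mul_div_cancel₀ _ h5]

theorem denominator_ne_zero {q b : ℂ} (hq : q ≠ 0) (hb0 : b ≠ 0) {m : ℤ} (hb : qAdmissible q b)
    (hbm : qAdmissible q (b * q ^ (m + 1))) (l : ℕ) :
    qPoch q⁻¹ (q⁻¹ ^ l * b⁻¹) (m + 1) ≠ 0 := by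
  rw [inv_pow, ← mul_inv, mul_comm]
  refine qPoch_inv_base_ne_zero hq (mul_ne_zero hb0 (pow_ne_zero _ hq)) (hb.mul_pow hq l) ?_
  rw [mul_right_comm]
  exact hbm.mul_pow hq l

/-- Here the index `m - i + 1` may be negative; the hypotheses on `b` and `b q^(m + 1)` exclude every
zero of the factors involved. -/
theorem denominator_factor_eq {q b : ℂ} (hq : q ≠ 0) (hb0 : b ≠ 0) {m : ℤ} (hb : qAdmissible q b)
    (hbm : qAdmissible q (b * q ^ (m + 1))) (i j : ℕ) :
    qPoch q (b * q ^ i) j / qPoch q (b * q ^ (m + 1)) j / qPoch q (q ^ (-m) / b) (m - i + 1) =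
      (qPochPoly q (q ^ (-m) / b) i).eval (q⁻¹ ^ (i + j)) /
        (qPoch q⁻¹ (q⁻¹ ^ (i + j) * b⁻¹) (m + 1) * (q ^ (m + 1 - i)) ^ j) := by
  have hbi0 : b * q ^ i ≠ 0 := mul_ne_zero hb0 (pow_ne_zero _ hq)
  have hbi := hb.mul_pow hq i
  have hbn : b * q ^ i * q ^ (m + 1 - i) = b * q ^ (m + 1) := by
    rw [mul_assoc, ← zpow_natCast q i, ← zpow_add₀ hq, add_sub_cancel]
  have h1 := qPoch_div_qPoch_mul_zpow hq hbi0 (k := m + 1 - i) hbi (by rwa [hbn]) j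
  have h2 : q⁻¹ ^ j * (b * q ^ i)⁻¹ = q⁻¹ ^ (i + j) * b⁻¹ := by
    rw [pow_add, mul_inv, inv_pow q i]
    ring
  have h3 : qPoch q (q ^ (-m) / b) (m - i + 1) = qPoch q⁻¹ (b * q ^ i)⁻¹ (m + 1 - i) := by
    rw [← qPoch_zpow_div_eq hq, show 1 - (m + 1) = -m by ring, sub_add_eq_add_sub]
  have h4 := denominator_ne_zero hq hb0 hb hbm (i + j)
  have h5 : qPoch q⁻¹ (q⁻¹ ^ (i + j) * b⁻¹) (m + 1) =
      qPoch q⁻¹ (q⁻¹ ^ (i + j) * b⁻¹) (m + 1 - i) *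
        (qPochPoly q (q ^ (-m) / b) i).eval (q⁻¹ ^ (i + j)) := by
    conv_lhs => rw [← sub_add_cancel (m + 1) (i : ℤ)]
    rw [qPoch_add_natCast (inv_ne_zero hq), eval_qPochPoly]
    · congr 1
      rw [← qPoch_mul_zpow_one_sub hq, inv_zpow, ← zpow_neg, mul_assoc, ← zpow_add₀ hq,
        mul_assoc, div_eq_mul_inv, mul_comm (q ^ (-m))]
      congr 4
      ring
    · intro t ht1 ht2
      obtain ⟨u, hu⟩ := Int.eq_ofNat_of_zero_le (show 0 ≤ i + j + t - (m + 1) by omega)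
      have h6 := hbm.one_sub_ne_zero u
      have h7 : b * q ^ (m + 1) * q ^ u ≠ 0 :=
        mul_ne_zero (mul_ne_zero hb0 (zpow_ne_zero _ hq)) (pow_ne_zero _ hq)
      have h8 : q⁻¹ ^ (i + j) * b⁻¹ * q⁻¹ ^ t = (b * q ^ (m + 1) * q ^ u)⁻¹ := by
        rw [mul_right_comm, ← zpow_natCast q⁻¹, ← zpow_add₀ (inv_ne_zero hq), mul_assoc,
          ← zpow_natCast q u, ← zpow_add₀ hq, mul_inv, inv_zpow, mul_comm]
        congr 3
        push_cast
        omega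
      rw [h8, one_sub_inv_eq h7]
      exact mul_ne_zero (neg_ne_zero.mpr (inv_ne_zero h7)) h6
  rw [h5] at h4
  have h6 := left_ne_zero_of_mul h4
  have h7 := right_ne_zero_of_mul h4
  have h8 : qPoch q⁻¹ (b * q ^ i)⁻¹ (m + 1 - i) ≠ 0 :=
    qPoch_inv_base_ne_zero hq hbi0 hbi (by rwa [hbn])
  rw [hbn, h2] at h1
  rw [h1, h3, h5]
  have h9 := pow_ne_zero j (zpow_ne_zero (m + 1 - i) hq)
  generalize qPoch q⁻¹ (b * q ^ i)⁻¹ (m + 1 - i) = u1 at *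
  generalize qPoch q⁻¹ (q⁻¹ ^ (i + j) * b⁻¹) (m + 1 - i) = u2 at *
  generalize (qPochPoly q (q ^ (-m) / b) i).eval (q⁻¹ ^ (i + j)) = u3 at *
  generalize (q ^ (m + 1 - i)) ^ j = u4 at *
  field_simp

theorem power_factor_eq {q : ℂ} (hq : q ≠ 0) (m : ℤ) {r : ℕ} (n : Fin r → ℕ) (s : ℕ) {i : ℕ}
    (hi : ∀ k, i ≤ n k) (j : ℕ) :
    q ^ (s * i) * q ^ ((j + 1) * i) *
        (q ^ (m + 1 - (∑ k, (n k : ℤ)) + (s : ℤ) + ((r : ℤ) - 2) * (i : ℤ))) ^ j *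
        (∏ k, (q ^ (n k - i)) ^ j) / (q ^ (m + 1 - i)) ^ j =
      q ^ i / (q⁻¹ ^ (i + j)) ^ s := by
  have h1 : ∏ k, (q ^ (n k - i)) ^ j = q ^ (((∑ k, (n k : ℤ)) - r * i) * j) := by
    rw [Finset.prod_pow, Finset.prod_pow_eq_pow_sum, ← zpow_natCast, ← zpow_natCast, ← zpow_mul]
    congr 2
    push_cast [Nat.cast_sub (hi _)]
    rw [Finset.sum_sub_distrib]
    simp
  rw [h1, inv_pow, inv_pow, div_inv_eq_mul, ← pow_mul]
  simp only [← zpow_natCast, ← zpow_mul, ← zpow_add₀ hq, ← zpow_sub₀ hq]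
  congr 1
  push_cast
  ring

/-- The `j`-th summand of the `i`-th series on the left of the second transformation, as the summand
with index `l = i + j` of `qBinomialSum`. The numerator polynomial contains the factor `(w; q)_i`,
which vanishes for `l < i`. -/
theorem summand_eq_shifted {q : ℂ} (hq : q ≠ 0) (hq1 : ‖q‖ < 1) (m : ℤ) {r : ℕ} (n : Fin r → ℕ)
    (s : ℕ) {a b : ℂ} {c : Fin r → ℂ} (ha : a ≠ 0) (hb0 : b ≠ 0) (hc0 : ∀ k, c k ≠ 0)
    (hb : qAdmissible q b) (hbm : qAdmissible q (b * q ^ (m + 1)))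
    (hc : ∀ k, qAdmissible q (c k)) {i : ℕ} (hi : ∀ k, i ≤ n k) (j : ℕ) :
    qPoch q (q ^ (-(s : ℤ))) i / qPoch q q i * q ^ (s * i)
        * ((qPochInf q (q ^ (1 - (i : ℤ)) / a)
              * ∏ k, qPoch q (q ^ (1 - (n k : ℤ)) / c k) ((n k : ℤ) - i))
            / (qPochInf q q * qPoch q (q ^ (-m) / b) (m - i + 1)))
        * qHypTerm q (a * q ^ i)
            (Matrix.vecCons (b * q ^ i) (fun k => c k * q ^ n k))
            (Matrix.vecCons (b * q ^ (m + 1)) (fun k => c k * q ^ i))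
            (a⁻¹ * q ^ (m + 1 - (∑ k, (n k : ℤ)) + (s : ℤ) + ((r : ℤ) - 2) * (i : ℤ))) j =
      qPochInf q (q / a) / qPochInf q q *
        (qPoch q a ((i + j : ℕ) : ℤ) / qPoch q q ((i + j : ℕ) : ℤ) * a⁻¹ ^ (i + j) *
        ((Polynomial.C (qPoch q (q ^ (-(s : ℤ))) i / qPoch q q i * q ^ i) *
          (qPochPoly q 1 i * qPochPoly q (q ^ (-m) / b) i *
          ∏ k, qPochPoly q (q ^ (1 - (n k : ℤ)) / c k * q ^ i) (n k - i))).eval (q⁻¹ ^ (i + j)) /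
          ((q⁻¹ ^ (i + j)) ^ s * qPoch q⁻¹ (q⁻¹ ^ (i + j) * b⁻¹) (m + 1)))) := by
  have eA := qPochInf_zpow_div_mul_qPoch hq hq1 ha i j
  have eQ := inv_qPoch_self_eq hq hq1 i j
  have eB := denominator_factor_eq hq hb0 hb hbm i j
  have eC : (∏ k, qPoch q (q ^ (1 - (n k : ℤ)) / c k) ((n k : ℤ) - i)) *
      ((∏ k, qPoch q (c k * q ^ n k) j) / ∏ k, qPoch q (c k * q ^ i) j) =
      (∏ k, (qPochPoly q (q ^ (1 - (n k : ℤ)) / c k * q ^ i) (n k - i)).eval (q⁻¹ ^ (i + j))) *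
        ∏ k, (q ^ (n k - i)) ^ j := by
    rw [← Finset.prod_div_distrib, ← Finset.prod_mul_distrib, ← Finset.prod_mul_distrib]
    exact Finset.prod_congr rfl fun k _ => numerator_factor_eq hq (hc0 k) (hc k) (hi k) j
  have eP := power_factor_eq hq m n s hi j
  have hκ := mul_inv_cancel₀ (prod_neg_inv_pow_ne_zero hq i)
  have e1 : (qPochPoly q 1 i).eval (q⁻¹ ^ (i + j)) = qPoch q (q⁻¹ ^ (i + j)) i := by
    rw [eval_qPochPoly, mul_one]
  simp only [Polynomial.eval_mul, Polynomial.eval_C, Polynomial.eval_prod, e1]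
  rw [qHypTerm_vecCons, mul_pow, pow_add a⁻¹]
  generalize q ^ (m + 1 - (∑ k, (n k : ℤ)) + (s : ℤ) + ((r : ℤ) - 2) * (i : ℤ)) = x0 at *
  generalize ∏ t ∈ Finset.range i, -(q⁻¹ ^ t) = κ at *
  generalize qPoch q (q ^ (-(s : ℤ))) i / qPoch q q i = x1 at *
  generalize qPochInf q (q ^ (1 - (i : ℤ)) / a) = x2 at *
  generalize qPoch q (a * q ^ i) j = x3 at *
  generalize qPoch q a ((i + j : ℕ) : ℤ) = x4 at *
  generalize qPochInf q (q / a) = x5 at *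
  generalize qPochInf q q = x6 at *
  generalize qPoch q (q⁻¹ ^ (i + j)) i = x7 at *
  generalize qPoch q q j = x8 at *
  generalize qPoch q q ((i + j : ℕ) : ℤ) = x9 at *
  generalize (qPochPoly q (q ^ (-m) / b) i).eval (q⁻¹ ^ (i + j)) = x10 at *
  generalize qPoch q⁻¹ (q⁻¹ ^ (i + j) * b⁻¹) (m + 1) = x11 at *
  generalize (q ^ (m + 1 - i)) ^ j = x12 at *
  generalize qPoch q (q ^ (-m) / b) (m - i + 1) = x13 at *
  generalize qPoch q (b * q ^ i) j = x14 at *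
  generalize qPoch q (b * q ^ (m + 1)) j = x15 at *
  generalize (∏ k, qPoch q (q ^ (1 - (n k : ℤ)) / c k) ((n k : ℤ) - i)) = x16 at *
  generalize (∏ k, qPoch q (c k * q ^ n k) j) = x17 at *
  generalize (∏ k, qPoch q (c k * q ^ i) j) = x18 at *
  generalize (∏ k, (qPochPoly q (q ^ (1 - (n k : ℤ)) / c k * q ^ i) (n k - i)).eval
    (q⁻¹ ^ (i + j))) = x19 at *
  generalize (∏ k, (q ^ (n k - i)) ^ j) = x20 at *
  generalize (q⁻¹ ^ (i + j)) ^ s = x21 at *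
  calc _ = x1 * (x2 * x3) * (x14 / x15 / x13) * (x16 * (x17 / x18)) * x8⁻¹ * x6⁻¹ *
        a⁻¹ ^ j * (q ^ (s * i) * x0 ^ j) := by
        generalize q ^ (s * i) = y1
        ring
    _ = x1 * x5 * x4 / x6 * (x10 / x11) * x19 * x7 / x9 * a⁻¹ ^ i * a⁻¹ ^ j * (κ * κ⁻¹) *
        (q ^ (s * i) * q ^ ((j + 1) * i) * x0 ^ j * x20 / x12) := by
        rw [eA, eB, eC, eQ]
        generalize q ^ (s * i) = y1
        generalize q ^ ((j + 1) * i) = y2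
        ring
    _ = _ := by
        rw [eP, hκ]
        ring

/-! ### The second transformation -/

theorem qPoch_div_qPochInf_comm {q b : ℂ} (hq : q ≠ 0) (hq1 : ‖q‖ < 1) (hb : qAdmissible q b)
    (i j : ℕ) :
    qPoch q (b * q ^ j) i / qPochInf q (b * q ^ j) =
      qPoch q (b * q ^ i) j / qPochInf q (b * q ^ i) := by
  have h1 : ∀ i j : ℕ, qPoch q (b * q ^ j) i / qPochInf q (b * q ^ j) =
      (qPochInf q (b * q ^ (i + j)))⁻¹ := fun i j => by
    rw [qPochInf_eq_mul hq1 (b * q ^ j) i, ← div_div,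
      div_self (qPoch_natCast_ne_zero (hb.mul_pow hq j) i), one_div, mul_assoc b, ← pow_add,
      add_comm]
  rw [h1, h1, add_comm]

theorem qPoch_zpow_neg_index_eq_zero {q : ℂ} (hq : q ≠ 0) {k : ℤ} (hk : 0 < k) :
    qPoch q (q ^ k) (-k) = 0 := by
  obtain ⟨n, rfl⟩ := Int.eq_succ_of_zero_lt hk
  rw [← Nat.cast_succ, qPoch_neg_natCast, inv_eq_zero]
  refine Finset.prod_eq_zero (Finset.mem_range.mpr n.lt_succ_self) ?_
  rw [← zpow_add₀ hq, Nat.cast_succ, add_neg_cancel, zpow_zero, sub_self]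

/-- For `i > m` both sides vanish: the numerator on the left contains a zero factor, and on the
right `1 / (q^(i - m))_(m - i) = 0`. -/
theorem qPoch_zpow_neg_mul_div {q : ℂ} (hq : q ≠ 0) (hq1 : ‖q‖ < 1) (m i j : ℕ) :
    qPoch q (q ^ (-(m : ℤ))) j * qPoch q (q ^ (-(m : ℤ)) * q ^ j) i / qPoch q (q ^ (-(m : ℤ))) m =
      qPoch q (q ^ ((i : ℤ) - m)) j / qPoch q (q ^ ((i : ℤ) - m)) ((m : ℤ) - i) := by
  rw [← qPoch_natCast_add]
  rcases le_or_gt i m with h | h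
  · have h1 := qPoch_zpow_neg_self_ne_zero hq hq1 h
    obtain ⟨k, rfl⟩ := Nat.exists_eq_add_of_le h
    have h2 : q ^ (-((i + k : ℕ) : ℤ)) * q ^ i = q ^ ((i : ℤ) - (i + k : ℕ)) := by
      rw [← zpow_natCast q i, ← zpow_add₀ hq]
      congr 1
      ring
    rw [add_comm j i, qPoch_natCast_add, qPoch_natCast_add, h2, mul_div_mul_left _ _ h1]
    congr 2
    push_cast
    ring
  · rw [qPoch_zpow_neg_eq_zero hq (by omega), zero_div]
    have h3 := qPoch_zpow_neg_index_eq_zero hq (k := (i : ℤ) - m) (by omega)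
    rw [neg_sub] at h3
    rw [h3, div_zero]

theorem prod_qPoch_shift {q b : ℂ} (hq : q ≠ 0) {r : ℕ} (n : Fin r → ℕ) (c : Fin r → ℂ)
    (hbc : ∀ k, qAdmissible q (b * q ^ (1 - (n k : ℤ)) / c k)) {i : ℕ} (hi : ∀ k, i ≤ n k) (j : ℕ) :
    ∏ k, qPoch q (b * q ^ j * (q ^ (1 - (n k : ℤ)) / c k * q ^ i)) ((n k - i : ℕ) : ℤ) =
      (∏ k, qPoch q (b * q ^ (1 - (n k : ℤ) + (i : ℤ)) / c k) ((n k : ℤ) - i)) *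
        ((∏ k, qPoch q (b * q / c k) j) /
          ∏ k, qPoch q (b * q ^ (1 - (n k : ℤ) + (i : ℤ)) / c k) j) := by
  rw [← Finset.prod_div_distrib, ← Finset.prod_mul_distrib]
  refine Finset.prod_congr rfl fun k _ => ?_
  have h1 : b * q ^ (1 - (n k : ℤ) + (i : ℤ)) / c k = b * q ^ (1 - (n k : ℤ)) / c k * q ^ i := by
    rw [zpow_add₀ hq, zpow_natCast]
    ring
  have h2 : qPoch q (b * q ^ (1 - (n k : ℤ) + (i : ℤ)) / c k) j ≠ 0 := by
    rw [h1]
    exact qPoch_natCast_ne_zero ((hbc k).mul_pow hq i) j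
  have h3 : b * q ^ (1 - (n k : ℤ) + (i : ℤ)) / c k * q ^ (n k - i) = b * q / c k := by
    rw [div_mul_eq_mul_div, mul_assoc, ← zpow_natCast q (n k - i), ← zpow_add₀ hq,
      Nat.cast_sub (hi k), show 1 - (n k : ℤ) + i + (n k - i) = 1 by ring, zpow_one]
  have h4 : b * q ^ j * (q ^ (1 - (n k : ℤ)) / c k * q ^ i) =
      b * q ^ (1 - (n k : ℤ) + (i : ℤ)) / c k * q ^ j := by
    rw [h1]
    ring
  rw [mul_div_assoc', eq_div_iff h2, h4, mul_comm, ← qPoch_natCast_add, ← Nat.cast_sub (hi k),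
    add_comm j, qPoch_natCast_add, h3]

/-- The residue at `w = b q^j` of the `i`-th term on the left equals the `j`-th summand of the `i`-th
series on the right. -/
theorem residue_eq_summand {q : ℂ} (hq : q ≠ 0) (hq1 : ‖q‖ < 1) (m : ℕ) {r : ℕ} (n : Fin r → ℕ)
    (s : ℕ) {a b : ℂ} {c : Fin r → ℂ} (hb0 : b ≠ 0) (hb : qAdmissible q b)
    (hba : qAdmissible q (b * q / a))
    (hbc : ∀ k, qAdmissible q (b * q ^ (1 - (n k : ℤ)) / c k)) {i : ℕ} (hi : ∀ k, i ≤ n k) (j : ℕ) :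
    -b / qPoch q (q ^ (-(m : ℤ))) m * (q ^ j * (qPoch q (q ^ (-(m : ℤ))) j / qPoch q q j) *
        ((Polynomial.C (qPoch q (q ^ (-(s : ℤ))) i / qPoch q q i * q ^ i) *
          (qPochPoly q 1 i * qPochPoly q (q ^ (-(m : ℤ)) / b) i *
          ∏ k, qPochPoly q (q ^ (1 - (n k : ℤ)) / c k * q ^ i) (n k - i))).eval (b * q ^ j) /
          (b * q ^ j) ^ s) *
        (qPochInf q (b * q ^ j * q / a) / qPochInf q (b * q ^ j))) =
      -(qPoch q (q ^ (-(s : ℤ))) i / qPoch q q i * q ^ i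
        * ((qPochInf q (b * q / a)
              * ∏ k, qPoch q (b * q ^ (1 - (n k : ℤ) + (i : ℤ)) / c k) ((n k : ℤ) - i))
            / (qPochInf q (b * q ^ i) * qPoch q (q ^ ((i : ℤ) - m)) (m - i)))
        * b ^ (1 - (s : ℤ))
        * qHypTerm q (q ^ ((i : ℤ) - m))
            (Matrix.vecCons (b * q ^ i) (fun k => b * q / c k))
            (Matrix.vecCons (b * q / a) (fun k => b * q ^ (1 - (n k : ℤ) + (i : ℤ)) / c k))
            (q ^ (1 - (s : ℤ))) j) := by
  have e1 := qPoch_div_qPochInf_comm hq hq1 hb i j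
  have e2 := qPoch_zpow_neg_mul_div hq hq1 m i j
  have e3 := prod_qPoch_shift hq n c hbc hi j
  have e4 : qPochInf q (b * q / a) = qPoch q (b * q / a) j * qPochInf q (b * q ^ j * q / a) := by
    rw [qPochInf_eq_mul hq1 _ j]
    congr 2
    ring
  have e5 : b * q ^ j / (b * q ^ j) ^ s = b ^ (1 - (s : ℤ)) * (q ^ (1 - (s : ℤ))) ^ j := by
    have h1 : (q ^ (1 - (s : ℤ))) ^ j = (q ^ j) ^ (1 - (s : ℤ)) := by
      rw [← zpow_natCast, ← zpow_natCast, zpow_comm]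
    rw [h1, ← mul_zpow, zpow_sub₀ (mul_ne_zero hb0 (pow_ne_zero _ hq)), zpow_one, zpow_natCast]
  have e6 : b * q ^ j * (q ^ (-(m : ℤ)) / b) = q ^ (-(m : ℤ)) * q ^ j := by
    field_simp
  have hB := mul_inv_cancel₀ (qPoch_natCast_ne_zero hba j)
  simp only [Polynomial.eval_mul, Polynomial.eval_C, Polynomial.eval_prod, eval_qPochPoly, mul_one,
    e6]
  rw [e3, qHypTerm_vecCons, e4]
  generalize qPoch q (q ^ (-(s : ℤ))) i / qPoch q q i = x1 at *
  generalize qPoch q (q ^ (-(m : ℤ))) m = x2 at *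
  generalize qPoch q (q ^ (-(m : ℤ))) j = x3 at *
  generalize qPoch q (q ^ (-(m : ℤ)) * q ^ j) i = x4 at *
  generalize qPoch q q j = x5 at *
  generalize qPoch q (b * q ^ j) i = x6 at *
  generalize qPochInf q (b * q ^ j) = x7 at *
  generalize qPochInf q (b * q ^ j * q / a) = x8 at *
  generalize qPoch q (b * q / a) j = x9 at *
  generalize qPoch q (b * q ^ i) j = x10 at *
  generalize qPochInf q (b * q ^ i) = x11 at *
  generalize qPoch q (q ^ ((i : ℤ) - m)) j = x12 at *
  generalize qPoch q (q ^ ((i : ℤ) - m)) ((m : ℤ) - i) = x13 at *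
  generalize (∏ k, qPoch q (b * q ^ (1 - (n k : ℤ) + (i : ℤ)) / c k) ((n k : ℤ) - i)) = x14 at *
  generalize (∏ k, qPoch q (b * q / c k) j) = x15 at *
  generalize (∏ k, qPoch q (b * q ^ (1 - (n k : ℤ) + (i : ℤ)) / c k) j) = x16 at *
  generalize b ^ (1 - (s : ℤ)) = x17 at *
  generalize (q ^ (1 - (s : ℤ))) ^ j = x18 at *
  calc _ = -(x1 * q ^ i * x8 * x14 * (x15 / x16) / x5 * (b * q ^ j / (b * q ^ j) ^ s) *
        (x6 / x7) * (x3 * x4 / x2)) := by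
        generalize (b * q ^ j) ^ s = y
        ring
    _ = -(x1 * q ^ i * x8 * x14 * (x15 / x16) / x5 * (x17 * x18) *
        (x10 / x11) * (x12 / x13)) * (x9 * x9⁻¹) := by
        rw [e1, e2, e5, hB, mul_one]
    _ = _ := by ring

/-- The numerator polynomials have degree at most `2 i + ∑ (n_k - i)`, which is largest at `i = 0` or
`i = s` according to the sign of `r - 2`. -/
theorem natDegree_summand_le {q : ℂ} {r : ℕ} (n : Fin r → ℕ) (s : ℕ) (x y d : ℂ) (z : Fin r → ℂ)
    {i : ℕ} (his : i ≤ s) (hi : ∀ k, i ≤ n k) :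
    ((Polynomial.C d * (qPochPoly q x i * qPochPoly q y i *
      ∏ k, qPochPoly q (z k) (n k - i))).natDegree : ℤ) ≤
      (∑ k, (n k : ℤ)) - min ((r : ℤ) - 2) 0 * s := by
  have h1 : (Polynomial.C d * (qPochPoly q x i * qPochPoly q y i *
      ∏ k, qPochPoly q (z k) (n k - i))).natDegree ≤ i + i + ∑ k, (n k - i) := by
    refine (Polynomial.natDegree_C_mul_le _ _).trans (Polynomial.natDegree_mul_le.trans
      (add_le_add (Polynomial.natDegree_mul_le.trans (add_le_add (natDegree_qPochPoly_le _ _ _)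
        (natDegree_qPochPoly_le _ _ _))) ?_))
    exact (Polynomial.natDegree_prod_le _ _).trans
      (Finset.sum_le_sum fun k _ => natDegree_qPochPoly_le _ _ _)
  have h2 : ((∑ k, (n k - i) : ℕ) : ℤ) = (∑ k, (n k : ℤ)) - r * i := by
    push_cast [Nat.cast_sub (hi _)]
    rw [Finset.sum_sub_distrib]
    simp
  have h3 : (2 - (r : ℤ)) * i ≤ -(min ((r : ℤ) - 2) 0 * s) := by
    have h4 : (i : ℤ) ≤ s := by exact_mod_cast his
    rcases le_total ((r : ℤ) - 2) 0 with h | h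
    · rw [min_eq_left h]
      nlinarith
    · rw [min_eq_right h]
      nlinarith
  zify at h1
  rw [← Nat.cast_sum, h2] at h1
  linarith

theorem qHypTerm_zpow_sub_eq_zero {q : ℂ} (hq : q ≠ 0) {i m : ℕ} (h : i ≤ m) {r : ℕ}
    (b c : Fin r → ℂ) (x : ℂ) {j : ℕ} (hj : m - i < j) :
    qHypTerm q (q ^ ((i : ℤ) - m)) b c x j = 0 := by
  rw [qHypTerm, show (i : ℤ) - m = -((m - i : ℕ) : ℤ) by omega, qPoch_zpow_neg_eq_zero hq hj]
  simp

/-- The second transformation. No condition on `(q / a)_∞` is needed: the factor is part of the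
left-hand side. -/
theorem sum_qHyp_transformation {q : ℂ} (hq0 : q ≠ 0) (hq1 : ‖q‖ < 1)
    (m : ℤ) {r : ℕ} (n : Fin r → ℕ) (s : ℕ) {a b : ℂ} {c : Fin r → ℂ}
    (ha : a ≠ 0) (hb : b ≠ 0) (hc : ∀ k, c k ≠ 0)
    (hbm : qAdmissible q (b * q ^ (m + 1))) (hcq : ∀ k, qAdmissible q (c k))
    (hba : qAdmissible q (b * q / a))
    (hbc : ∀ k, qAdmissible q (b * q ^ (1 - (n k : ℤ)) / c k)) (hb1 : qAdmissible q b)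
    (hx : ‖a⁻¹ * q ^ (m + 1 - (∑ k, (n k : ℤ)) + (s : ℤ) + min ((r : ℤ) - 2) 0 * (s : ℤ))‖ < 1)
    (hs : ∀ k, s ≤ n k)
    (hsum : ∀ i : ℕ, i ≤ s → Summable (qHypTerm q (a * q ^ i)
        (Matrix.vecCons (b * q ^ i) (fun k => c k * q ^ n k))
        (Matrix.vecCons (b * q ^ (m + 1)) (fun k => c k * q ^ i))
        (a⁻¹ * q ^ (m + 1 - (∑ k, (n k : ℤ)) + (s : ℤ) + ((r : ℤ) - 2) * (i : ℤ))))) :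
    ∑ i ∈ Finset.range (s + 1),
        qPoch q (q ^ (-(s : ℤ))) i / qPoch q q i * q ^ (s * i)
        * ((qPochInf q (q ^ (1 - (i : ℤ)) / a)
              * ∏ k, qPoch q (q ^ (1 - (n k : ℤ)) / c k) ((n k : ℤ) - i))
            / (qPochInf q q * qPoch q (q ^ (-m) / b) (m - i + 1)))
        * qHyp q (a * q ^ i)
            (Matrix.vecCons (b * q ^ i) (fun k => c k * q ^ n k))
            (Matrix.vecCons (b * q ^ (m + 1)) (fun k => c k * q ^ i))
            (a⁻¹ * q ^ (m + 1 - (∑ k, (n k : ℤ)) + (s : ℤ) + ((r : ℤ) - 2) * (i : ℤ)))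
      = - ∑ i ∈ Finset.range (s + 1),
        qPoch q (q ^ (-(s : ℤ))) i / qPoch q q i * q ^ i
        * ((qPochInf q (b * q / a)
              * ∏ k, qPoch q (b * q ^ (1 - (n k : ℤ) + (i : ℤ)) / c k) ((n k : ℤ) - i))
            / (qPochInf q (b * q ^ i) * qPoch q (q ^ ((i : ℤ) - m)) (m - i)))
        * b ^ (1 - (s : ℤ))
        * qHyp q (q ^ ((i : ℤ) - m))
            (Matrix.vecCons (b * q ^ i) (fun k => b * q / c k))
            (Matrix.vecCons (b * q / a) (fun k => b * q ^ (1 - (n k : ℤ) + (i : ℤ)) / c k))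
            (q ^ (1 - (s : ℤ))) := by
  have hle : ∀ i ∈ Finset.range (s + 1), i ≤ s ∧ ∀ k, i ≤ n k := fun i hi =>
    have h := Nat.lt_succ_iff.mp (Finset.mem_range.mp hi)
    ⟨h, fun k => h.trans (hs k)⟩
  set P : ℕ → Polynomial ℂ := fun i =>
    Polynomial.C (qPoch q (q ^ (-(s : ℤ))) i / qPoch q q i * q ^ i) *
      (qPochPoly q 1 i * qPochPoly q (q ^ (-m) / b) i *
        ∏ k, qPochPoly q (q ^ (1 - (n k : ℤ)) / c k * q ^ i) (n k - i)) with hP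
  obtain ⟨R, hR⟩ : (Polynomial.X ^ s : Polynomial ℂ) ∣ ∑ i ∈ Finset.range (s + 1), P i :=
    X_pow_dvd_sum_qPochPoly hq0 hq1 _ _ (fun k => q ^ (1 - (n k : ℤ)) / c k) n hs
  have hReval : ∀ w : ℂ, w ≠ 0 →
      R.eval w = ∑ i ∈ Finset.range (s + 1), (P i).eval w / w ^ s := fun w hw => by
    have h1 := congrArg (Polynomial.eval w) hR
    rw [Polynomial.eval_finsetSum, Polynomial.eval_mul, Polynomial.eval_pow,
      Polynomial.eval_X] at h1
    rw [← Finset.sum_div, h1, mul_div_cancel_left₀ _ (pow_ne_zero s hw)]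
  -- `R` may be zero, so the bound on its degree also needs the right-hand side to be nonnegative.
  have hRdeg : (R.natDegree : ℤ) ≤ (∑ k, (n k : ℤ)) - min ((r : ℤ) - 2) 0 * s - s := by
    rcases eq_or_ne R 0 with rfl | hR0
    · rw [Polynomial.natDegree_zero]
      have h1 : (r : ℤ) * s ≤ ∑ k, (n k : ℤ) := by
        have := Finset.card_nsmul_le_sum (Finset.univ : Finset (Fin r)) (fun k => (n k : ℤ)) s
          fun k _ => by exact_mod_cast hs k
        simpa using this
      have h2 : (0 : ℤ) ≤ s := by positivity
      rcases le_total ((r : ℤ) - 2) 0 with h | h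
      · rw [min_eq_left h]
        push_cast
        nlinarith
      · rw [min_eq_right h]
        push_cast
        nlinarith
    · have h1 : (∑ i ∈ Finset.range (s + 1), P i).natDegree = s + R.natDegree := by
        rw [hR, Polynomial.natDegree_mul (pow_ne_zero _ Polynomial.X_ne_zero) hR0,
          Polynomial.natDegree_X_pow]
      have h2 : ((∑ i ∈ Finset.range (s + 1), P i).natDegree : ℤ) ≤
          (∑ k, (n k : ℤ)) - min ((r : ℤ) - 2) 0 * s := by
        have h0 : 0 ≤ (∑ k, (n k : ℤ)) - min ((r : ℤ) - 2) 0 * s :=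
          le_trans (Int.natCast_nonneg _) (natDegree_summand_le (q := q) n s 1 1 1
            (fun _ => 1) s.zero_le fun k => (n k).zero_le)
        have h3 : (∑ i ∈ Finset.range (s + 1), P i).natDegree ≤
            ((∑ k, (n k : ℤ)) - min ((r : ℤ) - 2) 0 * s).toNat :=
          Polynomial.natDegree_sum_le_of_forall_le _ _ fun i hi => by
            have := natDegree_summand_le (q := q) n s 1 (q ^ (-m) / b)
              (qPoch q (q ^ (-(s : ℤ))) i / qPoch q q i * q ^ i)
              (fun k => q ^ (1 - (n k : ℤ)) / c k * q ^ i) (hle i hi).1 (hle i hi).2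
            simp only [hP]
            omega
        omega
      rw [h1] at h2
      push_cast at h2
      linarith
  have hmain := qPochInf_mul_qBinomialSum_div hq0 hq1 ha hb hb1 m R _ hRdeg (by
    convert hx using 4
    ring)
  have hterm : ∀ i ∈ Finset.range (s + 1), HasSum (fun l : ℕ =>
      qPochInf q (q / a) / qPochInf q q * (qPoch q a l / qPoch q q l * a⁻¹ ^ l *
        ((P i).eval (q⁻¹ ^ l) / ((q⁻¹ ^ l) ^ s * qPoch q⁻¹ (q⁻¹ ^ l * b⁻¹) (m + 1)))))
      (qPoch q (q ^ (-(s : ℤ))) i / qPoch q q i * q ^ (s * i)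
        * ((qPochInf q (q ^ (1 - (i : ℤ)) / a)
              * ∏ k, qPoch q (q ^ (1 - (n k : ℤ)) / c k) ((n k : ℤ) - i))
            / (qPochInf q q * qPoch q (q ^ (-m) / b) (m - i + 1)))
        * qHyp q (a * q ^ i)
            (Matrix.vecCons (b * q ^ i) (fun k => c k * q ^ n k))
            (Matrix.vecCons (b * q ^ (m + 1)) (fun k => c k * q ^ i))
            (a⁻¹ * q ^ (m + 1 - (∑ k, (n k : ℤ)) + (s : ℤ) + ((r : ℤ) - 2) * (i : ℤ)))) := by
    intro i hi
    refine (hasSum_nat_add_iff' i).mp ?_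
    have hzero : ∀ l ∈ Finset.range i, qPochInf q (q / a) / qPochInf q q *
        (qPoch q a l / qPoch q q l * a⁻¹ ^ l * ((P i).eval (q⁻¹ ^ l) /
          ((q⁻¹ ^ l) ^ s * qPoch q⁻¹ (q⁻¹ ^ l * b⁻¹) (m + 1)))) = 0 := by
      intro l hl
      have h1 : (P i).eval (q⁻¹ ^ l) = 0 := by
        simp only [hP, Polynomial.eval_mul, eval_qPochPoly, mul_one]
        rw [inv_pow, ← zpow_natCast, ← zpow_neg,
          qPoch_zpow_neg_eq_zero hq0 (Finset.mem_range.mp hl)]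
        ring
      rw [h1]
      ring
    rw [Finset.sum_eq_zero hzero, sub_zero]
    refine (((hsum i (hle i hi).1).hasSum).mul_left _).congr_fun fun j => ?_
    rw [add_comm j i]
    exact (summand_eq_shifted hq0 hq1 m n s ha hb hc hb1 hbm hcq (hle i hi).2 j).symm
  have hL := (hasSum_sum hterm).tsum_eq
  rw [← hL]
  have hL2 : ∑' l : ℕ, ∑ i ∈ Finset.range (s + 1), qPochInf q (q / a) / qPochInf q q *
      (qPoch q a l / qPoch q q l * a⁻¹ ^ l *
        ((P i).eval (q⁻¹ ^ l) / ((q⁻¹ ^ l) ^ s * qPoch q⁻¹ (q⁻¹ ^ l * b⁻¹) (m + 1)))) =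
      (qPochInf q (q / a) * qBinomialSum q a
        fun w => R.eval w / qPoch q⁻¹ (w * b⁻¹) (m + 1)) / qPochInf q q := by
    rw [mul_div_right_comm, qBinomialSum, ← tsum_mul_left]
    refine tsum_congr fun l => ?_
    rw [hReval _ (pow_ne_zero _ (inv_ne_zero hq0)), ← Finset.mul_sum, ← Finset.mul_sum,
      Finset.sum_div]
    simp only [div_div]
  have hqq := qPochInf_ne_zero hq1 (qAdmissible_self hq0 hq1)
  have hcancel : ∀ x y : ℂ, -b * qPochInf q q / x * y / qPochInf q q = -b / x * y := fun x y => by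
    calc _ = -b / x * y * (qPochInf q q / qPochInf q q) := by ring
      _ = _ := by rw [div_self hqq, mul_one]
  rw [hL2, hmain, hcancel]
  rcases lt_or_ge m 0 with hm | hm
  · rw [Int.toNat_of_nonpos (by omega), Finset.range_zero, Finset.sum_empty, mul_zero, eq_comm,
      neg_eq_zero]
    refine Finset.sum_eq_zero fun i _ => ?_
    have h1 := qPoch_zpow_neg_index_eq_zero hq0 (k := (i : ℤ) - m) (by omega)
    rw [neg_sub] at h1
    rw [h1]
    simp
  lift m to ℕ using hm
  rw [show ((m : ℤ) + 1).toNat = m + 1 by omega]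
  have hR2 : ∀ i : ℕ, (qPoch q (q ^ (-(s : ℤ))) i / qPoch q q i * q ^ i
        * ((qPochInf q (b * q / a)
              * ∏ k, qPoch q (b * q ^ (1 - (n k : ℤ) + (i : ℤ)) / c k) ((n k : ℤ) - i))
            / (qPochInf q (b * q ^ i) * qPoch q (q ^ ((i : ℤ) - m)) (m - i)))
        * b ^ (1 - (s : ℤ))
        * qHyp q (q ^ ((i : ℤ) - m))
            (Matrix.vecCons (b * q ^ i) (fun k => b * q / c k))
            (Matrix.vecCons (b * q / a) (fun k => b * q ^ (1 - (n k : ℤ) + (i : ℤ)) / c k))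
            (q ^ (1 - (s : ℤ)))) =
      ∑ j ∈ Finset.range (m + 1), (qPoch q (q ^ (-(s : ℤ))) i / qPoch q q i * q ^ i
        * ((qPochInf q (b * q / a)
              * ∏ k, qPoch q (b * q ^ (1 - (n k : ℤ) + (i : ℤ)) / c k) ((n k : ℤ) - i))
            / (qPochInf q (b * q ^ i) * qPoch q (q ^ ((i : ℤ) - m)) (m - i)))
        * b ^ (1 - (s : ℤ))
        * qHypTerm q (q ^ ((i : ℤ) - m))
            (Matrix.vecCons (b * q ^ i) (fun k => b * q / c k))
            (Matrix.vecCons (b * q / a) (fun k => b * q ^ (1 - (n k : ℤ) + (i : ℤ)) / c k))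
            (q ^ (1 - (s : ℤ))) j) := by
    intro i
    rw [← Finset.mul_sum]
    rcases le_or_gt i m with him | him
    · congr 1
      refine tsum_eq_sum fun j hj => qHypTerm_zpow_sub_eq_zero hq0 him _ _ _ ?_
      have := Finset.mem_range.not.mp hj
      omega
    · have h1 := qPoch_zpow_neg_index_eq_zero hq0 (k := (i : ℤ) - m) (by omega)
      rw [neg_sub] at h1
      rw [h1]
      simp
  simp only [hR2]
  rw [Finset.sum_comm, ← Finset.sum_neg_distrib, Finset.mul_sum]
  refine Finset.sum_congr rfl fun j _ => ?_
  rw [hReval _ (mul_ne_zero hb (pow_ne_zero _ hq0)), ← Finset.sum_neg_distrib, Finset.mul_sum,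
    Finset.sum_mul, Finset.mul_sum]
  exact Finset.sum_congr rfl fun i hi =>
    residue_eq_summand hq0 hq1 m n s hb hb1 hba hbc (hle i hi).2 j

/-! ### Assembly of both transformations -/

theorem qHyp_vecCons_one {q : ℂ} {r : ℕ} (a d x : ℂ) (β γ : Fin r → ℂ) :
    qHyp q a (Matrix.vecCons 1 β) (Matrix.vecCons d γ) x = 1 := by
  rw [qHyp, tsum_eq_single 0 fun i hi => ?_]
  · rw [qHypTerm_vecCons]
    simp [qPoch_zero]
  · obtain ⟨i, rfl⟩ := Nat.exists_eq_succ_of_ne_zero hi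
    have h1 : qPoch q 1 ((i + 1 : ℕ) : ℤ) = 0 := by
      rw [qPoch_natCast_succ', sub_self, zero_mul]
    rw [qHypTerm_vecCons, h1, zero_mul, mul_zero, zero_div, zero_mul]

theorem lemma3 (q : ℂ) (hq0 : q ≠ 0) (hq1 : ‖q‖ < 1)
    (m : ℤ) (r : ℕ) (n : Fin r → ℕ) (s : ℕ)
    (a b : ℂ) (c : Fin r → ℂ)
    (ha : a ≠ 0) (hb : b ≠ 0) (hc : ∀ k, c k ≠ 0)
    (hbm : qAdmissible q (b * q ^ (m + 1)))
    (hcq : ∀ k, qAdmissible q (c k))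
    (hba : qAdmissible q (b * q / a))
    (hbc : ∀ k, qAdmissible q (b * q ^ (1 - (n k : ℤ)) / c k)) :
    (qAdmissible q (q / a) → qAdmissible q (b * q) →
      ‖a⁻¹ * q ^ (m + 1 - (∑ k, (n k : ℤ)) - (s : ℤ))‖ < 1 →
      Summable (qHypTerm q a
        (Matrix.vecCons b (fun k => c k * q ^ n k))
        (Matrix.vecCons (b * q ^ (m + 1)) c)
        (a⁻¹ * q ^ (m + 1 - (∑ k, (n k : ℤ)) - (s : ℤ)))) ∧
      Summable (qHypTerm q (q ^ (-m))
        (Matrix.vecCons b (fun k => b * q / c k))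
        (Matrix.vecCons (b * q / a) (fun k => b * q ^ (1 - (n k : ℤ)) / c k))
        (q ^ (1 + s))) ∧
      qHyp q a
        (Matrix.vecCons b (fun k => c k * q ^ n k))
        (Matrix.vecCons (b * q ^ (m + 1)) c)
        (a⁻¹ * q ^ (m + 1 - (∑ k, (n k : ℤ)) - (s : ℤ)))
      = (qPochInf q q * qPochInf q (b * q / a) * qPoch q (b * q) m
            * ∏ k, qPoch q (c k / b) (n k))
          / (qPochInf q (q / a) * qPochInf q (b * q) * qPoch q q m
            * ∏ k, qPoch q (c k) (n k))
        * b ^ ((∑ k, (n k : ℤ)) - m + (s : ℤ))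
        * qHyp q (q ^ (-m))
            (Matrix.vecCons b (fun k => b * q / c k))
            (Matrix.vecCons (b * q / a) (fun k => b * q ^ (1 - (n k : ℤ)) / c k))
            (q ^ (1 + s))) ∧
    (qAdmissible q b →
      ‖a⁻¹ * q ^ (m + 1 - (∑ k, (n k : ℤ)) + (s : ℤ) + min ((r : ℤ) - 2) 0 * (s : ℤ))‖ < 1 →
      (∀ k, s ≤ n k) →
      (∀ i : ℕ, i ≤ s → Summable (qHypTerm q (a * q ^ i)
        (Matrix.vecCons (b * q ^ i) (fun k => c k * q ^ n k))
        (Matrix.vecCons (b * q ^ (m + 1)) (fun k => c k * q ^ i))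
        (a⁻¹ * q ^ (m + 1 - (∑ k, (n k : ℤ)) + (s : ℤ) + ((r : ℤ) - 2) * (i : ℤ))))) ∧
      (∀ i : ℕ, i ≤ s → (i : ℤ) ≤ m → Summable (qHypTerm q (q ^ ((i : ℤ) - m))
        (Matrix.vecCons (b * q ^ i) (fun k => b * q / c k))
        (Matrix.vecCons (b * q / a) (fun k => b * q ^ (1 - (n k : ℤ) + (i : ℤ)) / c k))
        (q ^ (1 - (s : ℤ))))) ∧
      ∑ i ∈ Finset.range (s + 1),
        qPoch q (q ^ (-(s : ℤ))) i / qPoch q q i * q ^ (s * i)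
        * ((qPochInf q (q ^ (1 - (i : ℤ)) / a)
              * ∏ k, qPoch q (q ^ (1 - (n k : ℤ)) / c k) ((n k : ℤ) - i))
            / (qPochInf q q * qPoch q (q ^ (-m) / b) (m - i + 1)))
        * qHyp q (a * q ^ i)
            (Matrix.vecCons (b * q ^ i) (fun k => c k * q ^ n k))
            (Matrix.vecCons (b * q ^ (m + 1)) (fun k => c k * q ^ i))
            (a⁻¹ * q ^ (m + 1 - (∑ k, (n k : ℤ)) + (s : ℤ) + ((r : ℤ) - 2) * (i : ℤ)))
      = - ∑ i ∈ Finset.range (s + 1),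
        qPoch q (q ^ (-(s : ℤ))) i / qPoch q q i * q ^ i
        * ((qPochInf q (b * q / a)
              * ∏ k, qPoch q (b * q ^ (1 - (n k : ℤ) + (i : ℤ)) / c k) ((n k : ℤ) - i))
            / (qPochInf q (b * q ^ i) * qPoch q (q ^ ((i : ℤ) - m)) (m - i)))
        * b ^ (1 - (s : ℤ))
        * qHyp q (q ^ ((i : ℤ) - m))
            (Matrix.vecCons (b * q ^ i) (fun k => b * q / c k))
            (Matrix.vecCons (b * q / a) (fun k => b * q ^ (1 - (n k : ℤ) + (i : ℤ)) / c k))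
            (q ^ (1 - (s : ℤ)))) := by
  refine ⟨fun hqa hbq hx => ⟨?_, ?_, ?_⟩, fun hb1 hx hs => ?_⟩
  · exact summable_qHypTerm hq0 hq1 _ _ _ (qAdmissible_vecCons hbm hcq) hx
  · refine summable_qHypTerm hq0 hq1 _ _ _ (qAdmissible_vecCons hba hbc) ?_
    rw [norm_pow]
    exact pow_lt_one₀ (norm_nonneg _) hq1 (by omega)
  · rcases eq_or_ne b 1 with rfl | hb1
    · -- Here `(b)_∞ = 0` and both series reduce to their first term; `m ≥ 0` by admissibility.
      have hm : 0 ≤ m := by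
        by_contra h
        refine hbm (-(m + 1)).toNat ?_
        rw [one_mul]
        congr 1
        omega
      lift m to ℕ using hm
      have h1 := qPochInf_ne_zero hq1 (qAdmissible_self hq0 hq1)
      have h2 := qPochInf_ne_zero hq1 hqa
      have h3 := qPoch_natCast_ne_zero (qAdmissible_self hq0 hq1) m
      have h4 : ∏ k, qPoch q (c k) (n k) ≠ 0 :=
        Finset.prod_ne_zero_iff.mpr fun k _ => qPoch_natCast_ne_zero (hcq k) (n k)
      simp only [qHyp_vecCons_one, one_mul, div_one, one_zpow, mul_one]
      rw [mul_comm (qPochInf q (q / a)), div_self]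
      exact mul_ne_zero (mul_ne_zero (mul_ne_zero h1 h2) h3) h4
    · refine qHyp_transformation hq0 hq1 m n s ha hb hc hbm hcq hba hbc hqa ?_ hx
      refine qAdmissible_of_one_sub_ne_zero hq0 fun k => ?_
      cases k with
      | zero => simpa [sub_eq_zero] using hb1.symm
      | succ k =>
        rw [pow_succ', ← mul_assoc]
        exact hbq.one_sub_ne_zero k
  · have hsum : ∀ i : ℕ, i ≤ s → Summable (qHypTerm q (a * q ^ i)
        (Matrix.vecCons (b * q ^ i) (fun k => c k * q ^ n k))
        (Matrix.vecCons (b * q ^ (m + 1)) (fun k => c k * q ^ i))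
        (a⁻¹ * q ^ (m + 1 - (∑ k, (n k : ℤ)) + (s : ℤ) + ((r : ℤ) - 2) * (i : ℤ)))) := by
      intro i hi
      refine summable_qHypTerm hq0 hq1 _ _ _
        (qAdmissible_vecCons hbm fun k => (hcq k).mul_pow hq0 i) (lt_of_le_of_lt ?_ hx)
      rw [norm_mul, norm_mul, norm_zpow, norm_zpow]
      refine mul_le_mul_of_nonneg_left (zpow_le_zpow_right_of_le_one₀ (norm_pos_iff.mpr hq0)
        hq1.le (add_le_add le_rfl ?_)) (norm_nonneg _)
      have h1 : (i : ℤ) ≤ s := by exact_mod_cast hi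
      rcases le_total ((r : ℤ) - 2) 0 with h | h
      · rw [min_eq_left h]
        nlinarith
      · rw [min_eq_right h]
        nlinarith
    refine ⟨hsum, fun i _ him => ?_,
      sum_qHyp_transformation hq0 hq1 m n s ha hb hc hbm hcq hba hbc hb1 hx hs hsum⟩
    lift m to ℕ using (by omega)
    have him' : i ≤ m := by exact_mod_cast him
    refine summable_of_ne_finset_zero (s := Finset.range (m - i + 1)) fun j hj =>
      qHypTerm_zpow_sub_eq_zero hq0 him' _ _ _ ?_
    have := Finset.mem_range.not.mp hj
    omega
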